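/- Let $n\ge 1$ and let $\bar E=B\otimes A$, where $B=\Gamma_{\mathbb Z}[x_2,x_4,\dots,x_{2n}]\otimes\Lambda_{\mathbb Z}(y_1,\dots,y_n)$ (the integral cohomology of $\Omega(SU(n+1)/T^n)$: a divided power algebra with $|x_{2i}|=2i$, whose divided powers are written $(x_{2i})_k$, tensor an exterior algebra with $|y_i|=1$) and $A=\mathbb Z[\gamma_1,\dots,\gamma_n]\cong\mathbb Z[\gamma_1,\dots,\gamma_{n+1}]/[\gamma_1+\cdots+\gamma_{n+1}]$ with $|\gamma_i|=2$. Let $D$ be the graded derivation of $\bar E$ with $$D(x_2)=\sum_{i=1}^n(-1)^{i+1}y_i\,(\gamma_1+\cdots+\gamma_{i-1}+2\gamma_i+\gamma_{i+1}+\cdots+\gamma_n),$$ so that $D((x_2)_m)=(x_2)_{m-1}D(x_2)$ for $m\ge1$, which vanishes on all $y_i$, all $\gamma_i$ and all divided powers of $x_4,\dots,x_{2n}$. (This is the $E_2$-page with $d^2$ of the Leray--Serre spectral sequence of the free loop fibration of $SU(n+1)/T^n$, before dividing by the symmetric ideal.) Let $A^p$ be the group of homogeneous polynomials of degree $p$ in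 the $\gamma_i$ (cohomological degree $2p$) and $B^q$ the part of $B$ of degree $q$, so $\bar E^{p,q}=A^p\otimes B^q$. For a set $S\subseteq B$ let $\bar E^{p,q}(S)=A^p\otimes\langle S\rangle^q$, where $\langle S\rangle^q$ is the degree $q$ part of the span of $S$, and let $H^*\bar E^{p,q}(S)$ be the group of classes, in the homology $\ker D/\operatorname{im}D$, of the cycles lying in $\bar E^{p,q}(S)$. For $1\le i_1<\cdots<i_j\le n$ let $\hat y_{i_1,\dots,i_j}$ be the product, in ascending order of indices, of all $y_k$ except $y_{i_1},\dots,y_{i_j}$; an expression containing $\hat y_{i_1,\dots,i_j}$ between brackets stands for the set of all such expressions with $j$ fixed and $i_1<\cdots<i_j$ varying. Let $\left(\!\binom{n}{k}\!\right)$ be the number of multisets of size $k$ from an $n$-element set, which is $0$ for $k<0$. Then for all $m,p\ge0$, all $1\le j\le n-1$ and every monomial $X$ in the divided powers of $x_4,\dots,x_{2n}$, \begin{align*} H^*\bar E^{0,\,n+2m+\dim X}((x_2)_mX\,y_1\cdots y_n)&\cong\mathbb Z,\\ H^*\bar E^{p,\,n+2m+\dim X}((x_2)_mX\,y_1\cdots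 y_n)&\cong\mathbb Z_{n+1}\quad\text{if }p>0,\\ H^*\bar E^{p,\,n-j+\dim X}(X\,\hat y_{i_1,\dots,i_j})&\cong\mathbb Z^{\sum_{k=0}^{n-j}(-1)^k\binom{n}{j+k}\left(\!\binom{n}{p-k}\!\right)},\\ H^*\bar E^{p,\,\dim X}(X)&\cong\mathbb Z^{\left(\!\binom{n}{p}\!\right)}, \end{align*} and everything else is trivial: for $m\ge1$ and $1\le j\le n$ one has $H^*\bar E^{p,\,n-j+2m+\dim X}((x_2)_mX\,\hat y_{i_1,\dots,i_j})=0$, and the homology of $(\bar E,D)$ is the internal direct sum of the groups $H^*\bar E^{p,\,n-j+2m+\dim X}((x_2)_mX\,\hat y_{i_1,\dots,i_j})$ over all $p,m\ge0$, $0\le j\le n$ and all $X$ (for $j=0$ the product is $y_1\cdots y_n$, for $j=n$ it is $1$). -/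

import Mathlib

open scoped TensorProduct

noncomputable section

namespace FlagLoop

/-! Everything is set up over a commutative ring `R`; the case of interest is `R = ℤ`. -/

/-! ### Derivations of the divided power algebra -/

section Deriv

open DividedPowerAlgebra

variable {R M : Type*} [CommRing R] [AddCommGroup M] [Module R M] (φ : M →ₗ[R] R)

/-- The value `φ(v) v_{k-1}` on the divided power `v_k` of the derivation attached to `φ`. -/
def dpPred : ℕ → M → DividedPowerAlgebra R M
  | 0, _ => 0
  | k + 1, v => φ v • dp R k v

theorem dpPred_smul (k : ℕ) (r : R) (v : M) : dpPred φ k (r • v) = r ^ k • dpPred φ k v := by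
  rcases k with _ | k
  · simp [dpPred]
  · simp only [dpPred, map_smul, dp_smul, smul_smul, smul_eq_mul]
    congr 1
    ring

theorem dpPred_mul (k l : ℕ) (v : M) :
    dp R k v * dpPred φ l v + dp R l v * dpPred φ k v
      = (k + l).choose k • dpPred φ (k + l) v := by
  rcases k with _ | k
  · simp [dpPred, dp_zero]
  rcases l with _ | l
  · simp [dpPred, dp_zero]
  have e3 : k + 1 + (l + 1) = k + l + 1 + 1 := by ring
  have h1 : dp R (k + 1) v * dp R l v = _ := dp_mul
  have h2 : dp R (l + 1) v * dp R k v = _ := dp_mul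
  rw [show k + 1 + l = k + l + 1 by ring] at h1
  rw [show l + 1 + k = k + l + 1 by ring] at h2
  have hs : (k + l + 1).choose (l + 1) = (k + l + 1).choose k := by
    rw [← Nat.choose_symm_of_eq_add (by ring : k + l + 1 = k + (l + 1))]
  rw [e3]
  simp only [dpPred, mul_smul_comm, h1, h2]
  rw [Nat.choose_succ_succ (k + l + 1) k, hs, add_smul, smul_comm (φ v), smul_comm (φ v), add_comm]

theorem dpPred_add (k : ℕ) (u v : M) :
    dpPred φ k (u + v) = ∑ x ∈ Finset.HasAntidiagonal.antidiagonal k,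
      (dp R x.1 u * dpPred φ x.2 v + dp R x.2 v * dpPred φ x.1 u) := by
  rcases k with _ | k
  · simp [dpPred]
  rw [Finset.sum_add_distrib, Finset.Nat.sum_antidiagonal_succ',
    Finset.Nat.sum_antidiagonal_succ]
  simp only [dpPred, mul_zero, mul_smul_comm, zero_add, map_add, dp_add, add_smul,
    Finset.smul_sum]
  rw [add_comm]
  simp only [mul_comm, Finset.sum_add_distrib]

/-- The algebra map `v_k ↦ v_k + ε φ(v) v_{k-1}` from the divided power algebra to its extension
by a square-zero `ε`. -/
def dpShift :
    DividedPowerAlgebra R M →ₐ[R]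
      TrivSqZeroExt (DividedPowerAlgebra R M) (DividedPowerAlgebra R M) :=
  DividedPowerAlgebra.lift'
    (f := fun kv => TrivSqZeroExt.inl (dp R kv.1 kv.2) +
      TrivSqZeroExt.inr (dpPred φ kv.1 kv.2))
    (fun v => by simp [dp_zero, dpPred])
    (fun k r v => by
      simp only [dp_smul, dpPred_smul, smul_add, TrivSqZeroExt.inl_smul, TrivSqZeroExt.inr_smul])
    (fun k l v => by
      refine TrivSqZeroExt.ext ?_ ?_
      · simp only [TrivSqZeroExt.fst_mul, TrivSqZeroExt.fst_add, TrivSqZeroExt.fst_inl,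
          TrivSqZeroExt.fst_inr, add_zero, TrivSqZeroExt.fst_smul, dp_mul]
      · simp only [TrivSqZeroExt.snd_mul, TrivSqZeroExt.snd_add, TrivSqZeroExt.fst_add,
          TrivSqZeroExt.fst_inl, TrivSqZeroExt.fst_inr, TrivSqZeroExt.snd_inl,
          TrivSqZeroExt.snd_inr, add_zero, zero_add, TrivSqZeroExt.snd_smul, smul_eq_mul,
          MulOpposite.smul_eq_mul_unop, MulOpposite.unop_op, ← dpPred_mul]
        rw [mul_comm (dpPred φ k v)])
    (fun k u v => by
      refine TrivSqZeroExt.ext ?_ ?_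
      · simp only [TrivSqZeroExt.fst_sum, TrivSqZeroExt.fst_mul, TrivSqZeroExt.fst_add,
          TrivSqZeroExt.fst_inl, TrivSqZeroExt.fst_inr, add_zero, dp_add]
      · simp only [TrivSqZeroExt.snd_sum, TrivSqZeroExt.snd_mul, TrivSqZeroExt.snd_add,
          TrivSqZeroExt.fst_add,
          TrivSqZeroExt.fst_inl, TrivSqZeroExt.fst_inr, TrivSqZeroExt.snd_inl,
          TrivSqZeroExt.snd_inr, add_zero, zero_add, smul_eq_mul,
          MulOpposite.smul_eq_mul_unop, MulOpposite.unop_op, dpPred_add]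
        exact Finset.sum_congr rfl fun x _ => by rw [mul_comm (dpPred φ x.1 u)])

theorem fst_dpShift (a : DividedPowerAlgebra R M) : (dpShift φ a).fst = a := by
  have h : (TrivSqZeroExt.fstHom R (DividedPowerAlgebra R M) (DividedPowerAlgebra R M)).comp
      (dpShift φ) = AlgHom.id R _ := by
    refine DividedPowerAlgebra.algHom_ext fun k v => ?_
    simp [dpShift]
  exact DFunLike.congr_fun h a

/-- The derivation of the divided power algebra attached to a linear form `φ`: it sends the
divided power `v_k` to `φ(v) v_{k-1}` (and `v_0 = 1` to `0`). -/
def dpDeriv : DividedPowerAlgebra R M →ₗ[R] DividedPowerAlgebra R M where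
  toFun a := (dpShift φ a).snd
  map_add' a b := by simp
  map_smul' r a := by simp

theorem dpDeriv_dp_zero (v : M) : dpDeriv φ (dp R 0 v) = 0 := by
  simp [dpDeriv, dpShift, dpPred]

theorem dpDeriv_dp_succ (k : ℕ) (v : M) :
    dpDeriv φ (dp R (k + 1) v) = φ v • dp R k v := by
  simp [dpDeriv, dpShift, dpPred]

theorem dpDeriv_mul (a b : DividedPowerAlgebra R M) :
    dpDeriv φ (a * b) = dpDeriv φ a * b + a * dpDeriv φ b := by
  simp [dpDeriv, fst_dpShift, mul_comm, add_comm]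

end Deriv

/-! ### The differential algebra `(Ē, D)` -/

section Algebra

variable (R : Type*) [CommRing R] (n : ℕ)

/-- The divided power algebra `Γ[x_2, x_4, …, x_{2n}]`, on a free module of rank `n`. -/
def Gam : Type _ := DividedPowerAlgebra R (Fin n → R)

instance : CommRing (Gam R n) := inferInstanceAs (CommRing (DividedPowerAlgebra R (Fin n → R)))

instance : Algebra R (Gam R n) := inferInstanceAs (Algebra R (DividedPowerAlgebra R (Fin n → R)))

/-- The exterior algebra `Λ(y_1, …, y_n)`. -/
abbrev Lam : Type _ := ExteriorAlgebra R (Fin n → R)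

/-- The polynomial ring `R[γ_1, …, γ_n] = R[γ_1, …, γ_{n+1}] / (γ_1 + ⋯ + γ_{n+1})`. -/
abbrev Pol : Type _ := MvPolynomial (Fin n) R

/-- `Γ[x_2, x_4, …, x_{2n}] ⊗ Λ(y_1, …, y_n)`, the cohomology of `Ω(SU(n+1)/T^n)`. -/
abbrev Fib : Type _ := Gam R n ⊗[R] Lam R n

/-- The algebra `Ē`. As `Γ` and `R[γ_1, …, γ_n]` live in even degrees, no signs enter the products
of the tensor factors. -/
abbrev Ebar : Type _ := Fib R n ⊗[R] Pol R n

instance : AddCommGroup (Ebar R n) := TensorProduct.addCommGroup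

variable {n}

/-- The divided power `(x_{2(i+1)})_k` (the indices `i : Fin n` start at `0`). -/
def xdp (i : Fin n) (k : ℕ) : Gam R n := DividedPowerAlgebra.dp R k (Pi.single i 1)

/-- The exterior generator `y_{i+1}`. -/
def y (i : Fin n) : Lam R n := ExteriorAlgebra.ι R (Pi.single i 1)

/-- The linear form `γ_1 + ⋯ + 2γ_i + ⋯ + γ_n`. -/
def gammaTilde (i : Fin n) : Pol R n := (∑ k, MvPolynomial.X k) + MvPolynomial.X i

theorem y_mul (i : Fin n) (l : Lam R n) :
    y R i * l = CliffordAlgebra.involute l * y R i := by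
  induction l using ExteriorAlgebra.induction with
  | algebraMap r => simp [Algebra.commutes]
  | ι v =>
    have h : CliffordAlgebra.involute (ExteriorAlgebra.ι R v) = -ExteriorAlgebra.ι R v :=
      CliffordAlgebra.involute_ι v
    rw [h, neg_mul, eq_neg_iff_add_eq_zero]
    exact ExteriorAlgebra.ι_add_mul_swap _ _
  | mul a b ha hb => rw [map_mul, ← mul_assoc, ha, mul_assoc, hb, mul_assoc]
  | add a b ha hb => rw [map_add, mul_add, add_mul, ha, hb]

variable (n)

/-- The automorphism of `Ē` that multiplies an element of total degree `d` by `(-1)^d`. -/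
def parity : Ebar R n →ₐ[R] Ebar R n :=
  Algebra.TensorProduct.map
    (Algebra.TensorProduct.map (AlgHom.id R (Gam R n)) CliffordAlgebra.involute)
    (AlgHom.id R (Pol R n))

variable [NeZero n]

/-- The partial derivation of `Γ` with respect to `x_2`. -/
def dx2 : Gam R n →ₗ[R] Gam R n where
  toFun := dpDeriv (M := Fin n → R) (LinearMap.proj 0)
  map_add' a b := (dpDeriv (M := Fin n → R) (LinearMap.proj 0)).map_add a b
  map_smul' r a := (dpDeriv (M := Fin n → R) (LinearMap.proj 0)).map_smul r a

/-- The differential `D`: the graded derivation with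
`D(x_2) = ∑_i (-1)^{i+1} y_i (γ_1 + ⋯ + 2γ_i + ⋯ + γ_n)` that vanishes on the `y_i`, the `γ_i`
and the divided powers of `x_4, …, x_{2n}`. (Here `i` starts at `0`, so the sign is `(-1)^i`.) -/
def D : Ebar R n →ₗ[R] Ebar R n :=
  ∑ i : Fin n, (-1 : R) ^ (i : ℕ) •
    TensorProduct.map (TensorProduct.map (dx2 R n) (LinearMap.mulLeft R (y R i)))
      (LinearMap.mulLeft R (gammaTilde R i))

theorem D_tmul (g : Gam R n) (l : Lam R n) (P : Pol R n) :
    D R n ((g ⊗ₜ l) ⊗ₜ P) = ∑ i : Fin n, (-1 : R) ^ (i : ℕ) •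
      ((dx2 R n g ⊗ₜ (y R i * l)) ⊗ₜ (gammaTilde R i * P)) := by
  simp [D, LinearMap.sum_apply]

theorem dx2_xdp_succ (k : ℕ) : dx2 R n (xdp R 0 (k + 1)) = xdp R 0 k := by
  refine (dpDeriv_dp_succ (M := Fin n → R) _ _ _).trans ?_
  simp [xdp]

theorem dx2_xdp_of_ne (i : Fin n) (hi : i ≠ 0) (k : ℕ) : dx2 R n (xdp R i k) = 0 := by
  rcases k with _ | k
  · exact dpDeriv_dp_zero _ _
  · refine (dpDeriv_dp_succ (M := Fin n → R) _ _ _).trans ?_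
    simp only [LinearMap.proj_apply, Pi.single_eq_of_ne hi.symm, zero_smul]
    rfl

theorem dx2_one : dx2 R n 1 = 0 := by
  have h := dpDeriv_dp_zero (LinearMap.proj (R := R) (φ := fun _ => R) (0 : Fin n)) 0
  rwa [DividedPowerAlgebra.dp_zero] at h

/-- The value of `D` on `x_2`. -/
theorem D_x2 : D R n ((xdp R 0 1 ⊗ₜ 1) ⊗ₜ 1) =
    ∑ i : Fin n, (-1 : R) ^ (i : ℕ) • ((1 ⊗ₜ y R i) ⊗ₜ gammaTilde R i) := by
  have h : dx2 R n (xdp R 0 1) = 1 := (dx2_xdp_succ R n 0).trans DividedPowerAlgebra.dp_zero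
  simp [D_tmul, h]

/-- `D` vanishes on `Λ(y_1, …, y_n) ⊗ R[γ_1, …, γ_n]`. -/
theorem D_one_tmul (l : Lam R n) (P : Pol R n) : D R n ((1 ⊗ₜ l) ⊗ₜ P) = 0 := by
  simp [D_tmul, dx2_one]

/-- `D` vanishes on the divided powers of `x_4, …, x_{2n}`. -/
theorem D_xdp_of_ne (i : Fin n) (hi : i ≠ 0) (k : ℕ) :
    D R n ((xdp R i k ⊗ₜ 1) ⊗ₜ 1) = 0 := by
  simp [D_tmul, dx2_xdp_of_ne R n i hi]

/-- The graded Leibniz rule. -/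
theorem D_mul (a b : Ebar R n) :
    D R n (a * b) = D R n a * b + parity R n a * D R n b := by
  induction a using TensorProduct.induction_on with
  | zero => simp
  | add a a' ha ha' => rw [add_mul, map_add, ha, ha', map_add, map_add]; noncomm_ring
  | tmul u P =>
  induction u using TensorProduct.induction_on with
  | zero => simp
  | add u u' hu hu' =>
    rw [TensorProduct.add_tmul, add_mul, map_add, hu, hu', map_add, map_add]; noncomm_ring
  | tmul g l =>
  induction b using TensorProduct.induction_on with
  | zero => simp
  | add b b' hb hb' => rw [mul_add, map_add, hb, hb', map_add]; noncomm_ring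
  | tmul w Q =>
  induction w using TensorProduct.induction_on with
  | zero => simp
  | add w w' hw hw' =>
    rw [TensorProduct.add_tmul, mul_add, map_add, hw, hw', map_add]; noncomm_ring
  | tmul h k =>
  simp only [D_tmul, Algebra.TensorProduct.tmul_mul_tmul, parity, Algebra.TensorProduct.map_tmul,
    AlgHom.coe_id, id_eq, Finset.sum_mul, Finset.mul_sum, ← Finset.sum_add_distrib,
    smul_mul_assoc, mul_smul_comm, ← smul_add]
  refine Finset.sum_congr rfl fun i _ => ?_
  have e1 : dx2 R n (g * h) = dx2 R n g * h + g * dx2 R n h := dpDeriv_mul _ _ _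
  rw [e1, TensorProduct.add_tmul, TensorProduct.add_tmul, ← mul_assoc (y R i) l k,
    ← mul_assoc (CliffordAlgebra.involute l), ← y_mul, mul_assoc (gammaTilde R i) P Q,
    mul_left_comm P]

/-- `D` is a differential. -/
theorem D_D : D R n ∘ₗ D R n = 0 := by
  refine TensorProduct.ext_threefold fun g l P => ?_
  rw [LinearMap.comp_apply, D_tmul, map_sum]
  simp only [map_smul, D_tmul, Finset.smul_sum, LinearMap.zero_apply]
  rw [← Finset.sum_product']
  have hy : ∀ i j : Fin n, y R j * (y R i * l) = -(y R i * (y R j * l)) := fun i j => by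
    rw [← mul_assoc, ← mul_assoc, eq_neg_iff_add_eq_zero, ← add_mul]
    have : y R j * y R i + y R i * y R j = 0 := ExteriorAlgebra.ι_add_mul_swap _ _
    rw [this, zero_mul]
  refine Finset.sum_involution (fun x _ => x.swap) ?_ ?_ (fun _ _ => by simp) (fun _ _ => by simp)
  · rintro ⟨i, j⟩ -
    simp only [Prod.swap]
    rw [hy i j, mul_left_comm (gammaTilde R j), TensorProduct.tmul_neg, TensorProduct.neg_tmul,
      smul_neg, smul_neg, smul_comm, neg_add_cancel]
  · rintro ⟨i, j⟩ - h e
    obtain rfl : j = i := congrArg Prod.fst e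
    refine h ?_
    have : y R j * y R j = 0 := ExteriorAlgebra.ι_sq_zero _
    simp only [← mul_assoc (y R j), this, zero_mul, TensorProduct.tmul_zero,
      TensorProduct.zero_tmul, smul_zero]

end Algebra

/-! ### Bigraded pieces and homology -/

section Pieces

variable (R : Type*) [CommRing R] (n : ℕ)

/-- The monomial `∏ i, (x_{2i})_{c_i}` in the divided powers. -/
def dpMonomial (c : Fin n → ℕ) : Gam R n := ∏ i, xdp R i (c i)

/-- The degree of `dpMonomial c`, where `|x_{2i}| = 2i`. -/
def dimX {n : ℕ} (c : Fin n → ℕ) : ℕ := ∑ i : Fin n, 2 * ((i : ℕ) + 1) * c i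

/-- The product, in ascending order of indices, of the `y_i` with `i ∈ I`. -/
def yProd (I : Finset (Fin n)) : Lam R n :=
  (List.ofFn fun k : Fin I.card => y R (I.orderEmbOfFin rfl k)).prod

/-- `ŷ_I`: the product, in ascending order of indices, of all `y_i` except those with `i ∈ I`.
In particular `ŷ_∅ = y_1 ⋯ y_n`, and `ŷ_I = 1` if `I` is the set of all indices. -/
def yHat (I : Finset (Fin n)) : Lam R n := yProd R n Iᶜ

/-- The degree `q` part `B^q` of `B = Γ[x_2, …, x_{2n}] ⊗ Λ(y_1, …, y_n)`. -/
def fibDeg (q : ℕ) : Submodule R (Fib R n) :=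
  Submodule.span R {b | ∃ (c : Fin n → ℕ) (I : Finset (Fin n)),
    dimX c + I.card = q ∧ b = dpMonomial R n c ⊗ₜ yProd R n I}

/-- For a set `S ⊆ B`, the part `A^p ⊗ ⟨S⟩^q` of `Ē^{p,q}`, where `A^p` consists of the
homogeneous polynomials of degree `p` in `γ_1, …, γ_n` (so of cohomological degree `2p`) and `⟨S⟩^q` is the degree `q` part of the
span of `S`. -/
def piece (p q : ℕ) (S : Set (Fib R n)) : Submodule R (Ebar R n) :=
  Submodule.span R {e | ∃ b ∈ Submodule.span R S ⊓ fibDeg R n q,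
    ∃ P ∈ MvPolynomial.homogeneousSubmodule (Fin n) R p, e = b ⊗ₜ P}

variable [NeZero n]

/-- The generators `(x_2)_m X ŷ_{i_1,…,i_j}`, for fixed `m`, `X = dpMonomial c` and `j`, and all
`i_1 < ⋯ < i_j`. -/
def gens (m : ℕ) (c : Fin n → ℕ) (j : ℕ) : Set (Fib R n) :=
  {b | ∃ I : Finset (Fin n), I.card = j ∧
    b = (xdp R 0 m * dpMonomial R n c) ⊗ₜ yHat R n I}

/-- The homology `ker D / im D` of `(Ē, D)`. -/
abbrev Homology : Type _ :=
  LinearMap.ker (D R n) ⧸ (LinearMap.range (D R n)).submoduleOf (LinearMap.ker (D R n))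

/-- `H^*Ē^{p,q}(S)`: the classes in the homology of `(Ē, D)` of the cycles that lie in
`A^p ⊗ ⟨S⟩^q`. -/
def HE (p q : ℕ) (S : Set (Fib R n)) : Submodule R (Homology R n) :=
  ((piece R n p q S).submoduleOf (LinearMap.ker (D R n))).map
    ((LinearMap.range (D R n)).submoduleOf (LinearMap.ker (D R n))).mkQ

end Pieces

/-- The multiset coefficient, the number of multisets of size `k` from a set with `n` elements;
it is `0` for negative `k`. -/
def multisetCoeff (n : ℕ) (k : ℤ) : ℕ := if 0 ≤ k then n.multichoose k.toNat else 0

end FlagLoop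

end

/-! The divided power monomials `(x_2)_m X` form a basis of `Γ[x_2, …, x_{2n}]`, and `D` sends
`(x_2)_m X ⊗ z` to `(x_2)_{m-1} X ⊗ K z`, where `K` is multiplication by
`ω = ∑ (-1)^{i+1} y_i γ̃_i` with `γ̃_i = γ_1 + ⋯ + 2γ_i + ⋯ + γ_n`, the differential of a Koszul
complex on `ℤ[γ_1, …, γ_n] ⊗ Λ(y_1, …, y_n)` (`D_kosEmbed_raise`, `kosCoord_D`). It raises both
the polynomial and the exterior degree by one. Hence everything splits into bihomogeneous pieces,
and the homology is the direct sum of their contributions (`isInternal_HE`). The boundaries in the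
piece of `(x_2)_m X ŷ_{i_1,…,i_j}` are the Koszul boundaries; the cycles are the Koszul cycles if
`m ≥ 1`, and everything if `m = 0`.

The forms `γ̃_i` are a regular sequence (`gammaTilde_regular`), so the Koszul complex is exact
except in the top exterior degree, where its homology is `ℤ[γ] / (γ̃_1, …, γ̃_n)`
(`kosMap_exact`). Modulo this ideal each `γ_i` becomes `-s` with `s = γ_1 + ⋯ + γ_n`, and the only
remaining relation is `(n + 1) s = 0`; so the quotient is `ℤ` in degree `0` and `ℤ/(n + 1)` in
each positive degree, which gives the pieces with `y_1 ⋯ y_n` (`nonempty_HE_top_equiv`). If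
generators `y_i` are omitted, exactness makes the pieces with `m ≥ 1` contribute nothing
(`HE_eq_bot`). For `m = 0` it identifies the piece modulo boundaries with its image under `K`, a
free group whose rank is an alternating sum of the ranks `(n choose k) * (n multichoose p)` of the
terms of the complex (`finrank_kosBoundary`, `nonempty_HE_lower_equiv`). -/

noncomputable section

namespace FlagLoop

/-! ### Koszul complexes of regular sequences -/

section AbstractKoszul

variable {A V ι : Type*} [CommRing A] [AddCommGroup V] [Module A V]

/-- For operators `Y i`, playing the role of multiplication by exterior generators, the submodule
generated from `vac` by the monomials in the `Y i` with `i ∈ L`. The recursion on the list `L`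
builds it as the sum of the monomials without and with the first generator. -/
def koszulSpan (Y : ι → Module.End A V) (vac : V) : List ι → Submodule A V
  | [] => A ∙ vac
  | i :: L => koszulSpan Y vac L ⊔ (koszulSpan Y vac L).map (Y i)

/-- The product of all `Y i` with `i ∈ L`, in the order of the list, applied to `vac`. -/
def koszulTop (Y : ι → Module.End A V) (vac : V) : List ι → V
  | [] => vac
  | i :: L => Y i (koszulTop Y vac L)

/-- The Koszul differential `∑ a_i Y_i`, the sum being over the list `L`. -/
def koszulMap (Y : ι → Module.End A V) (a : ι → A) (L : List ι) : Module.End A V :=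
  (L.map fun i => a i • Y i).sum

variable {Y d : ι → Module.End A V} {vac : V} {a : ι → A}

theorem koszulMap_cons (i : ι) (L : List ι) (z : V) :
    koszulMap Y a (i :: L) z = a i • Y i z + koszulMap Y a L z := by
  simp [koszulMap]

theorem koszulTop_mem (L : List ι) : koszulTop Y vac L ∈ koszulSpan Y vac L := by
  induction L with
  | nil => exact Submodule.mem_span_singleton_self _
  | cons i L ih => exact Submodule.mem_sup_right (Submodule.mem_map_of_mem ih)

theorem mem_koszulSpan_cons {i : ι} {L : List ι} {z : V} :
    z ∈ koszulSpan Y vac (i :: L) ↔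
      ∃ u ∈ koszulSpan Y vac L, ∃ v ∈ koszulSpan Y vac L, z = u + Y i v := by
  simp only [koszulSpan, Submodule.mem_sup, Submodule.mem_map]
  constructor
  · rintro ⟨u, hu, _, ⟨v, hv, rfl⟩, rfl⟩
    exact ⟨u, hu, v, hv, rfl⟩
  · rintro ⟨u, hu, v, hv, rfl⟩
    exact ⟨u, hu, _, ⟨v, hv, rfl⟩, rfl⟩

theorem apply_mem_koszulSpan (hYY : ∀ i j z, Y i (Y j z) = -Y j (Y i z))
    (hsq : ∀ i z, Y i (Y i z) = 0) {L : List ι} {j : ι} (hj : j ∈ L) {z : V}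
    (hz : z ∈ koszulSpan Y vac L) : Y j z ∈ koszulSpan Y vac L := by
  induction L generalizing z with
  | nil => simp at hj
  | cons i L ih =>
    obtain ⟨u, hu, v, hv, rfl⟩ := mem_koszulSpan_cons.1 hz
    rw [map_add]
    by_cases hij : j = i
    · subst hij
      exact mem_koszulSpan_cons.2 ⟨0, zero_mem _, u, hu, by simp [hsq]⟩
    · have hj' : j ∈ L := by simpa [hij] using hj
      exact mem_koszulSpan_cons.2 ⟨_, ih hj' hu, _, neg_mem (ih hj' hv), by rw [hYY j i, map_neg]⟩

theorem contract_koszulSpan (hdY : ∀ i j z, i ≠ j → d i (Y j z) = -Y j (d i z))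
    (hvac : ∀ i, d i vac = 0) {L : List ι} {j : ι} (hj : j ∉ L) {z : V}
    (hz : z ∈ koszulSpan Y vac L) : d j z = 0 := by
  induction L generalizing z with
  | nil =>
    obtain ⟨c, rfl⟩ := Submodule.mem_span_singleton.1 hz
    simp [hvac]
  | cons i L ih =>
    obtain ⟨u, hu, v, hv, rfl⟩ := mem_koszulSpan_cons.1 hz
    obtain ⟨hji, hjL⟩ : j ≠ i ∧ j ∉ L := by simpa using hj
    rw [map_add, ih hjL hu, hdY _ _ _ hji, ih hjL hv, map_zero, neg_zero, add_zero]

theorem apply_koszulMap (hYY : ∀ i j z, Y i (Y j z) = -Y j (Y i z)) (i : ι) (L : List ι) (z : V) :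
    Y i (koszulMap Y a L z) = -koszulMap Y a L (Y i z) := by
  induction L with
  | nil => simp [koszulMap]
  | cons j L ih =>
    simp only [koszulMap_cons, map_add, map_smul, ih]
    rw [hYY i j]
    module

theorem koszulMap_koszulMap (hYY : ∀ i j z, Y i (Y j z) = -Y j (Y i z))
    (hsq : ∀ i z, Y i (Y i z) = 0) (L : List ι) (z : V) :
    koszulMap Y a L (koszulMap Y a L z) = 0 := by
  induction L with
  | nil => simp [koszulMap]
  | cons i L ih =>
    simp only [koszulMap_cons, map_add, map_smul, ih, hsq, apply_koszulMap hYY]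
    module

theorem contract_koszulMap (hdY : ∀ i j z, i ≠ j → d i (Y j z) = -Y j (d i z))
    {i : ι} {L : List ι} (hi : i ∉ L) (z : V) :
    d i (koszulMap Y a L z) = -koszulMap Y a L (d i z) := by
  induction L with
  | nil => simp [koszulMap]
  | cons j L ih =>
    obtain ⟨hij, hiL⟩ : i ≠ j ∧ i ∉ L := by simpa using hi
    simp only [koszulMap_cons, map_add, map_smul, ih hiL]
    rw [hdY _ _ _ hij]
    module

theorem apply_koszulTop (hYY : ∀ i j z, Y i (Y j z) = -Y j (Y i z))
    (hsq : ∀ i z, Y i (Y i z) = 0) {L : List ι} {j : ι} (hj : j ∈ L) :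
    Y j (koszulTop Y vac L) = 0 := by
  induction L with
  | nil => simp at hj
  | cons i L ih =>
    rcases List.mem_cons.1 hj with rfl | hj
    · exact hsq _ _
    · rw [koszulTop, hYY, ih hj, map_zero, neg_zero]

theorem koszulMap_koszulTop (hYY : ∀ i j z, Y i (Y j z) = -Y j (Y i z))
    (hsq : ∀ i z, Y i (Y i z) = 0) (L : List ι) :
    koszulMap Y a L (koszulTop Y vac L) = 0 := by
  rw [koszulMap, ← LinearMap.applyₗ_apply_apply (R := A) (koszulTop Y vac L), map_list_sum]
  refine List.sum_eq_zero fun x hx => ?_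
  obtain ⟨i, hi, rfl⟩ : ∃ i ∈ L, a i • Y i (koszulTop Y vac L) = x := by simpa using hx
  rw [apply_koszulTop hYY hsq hi, smul_zero]

/-- The two components of `0 = p + Y i q` vanish if `p` and `q` do not involve `Y i`, which is
expressed by the vanishing of their contraction with the `i`th dual generator. -/
theorem eq_zero_of_add_apply_eq_zero (hd : ∀ i z, d i (Y i z) = z - Y i (d i z)) {i : ι} {p q : V}
    (hp : d i p = 0) (hq : d i q = 0) (h : p + Y i q = 0) : p = 0 ∧ q = 0 := by
  have hq0 : q = 0 := by
    have := congrArg (d i) h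
    simpa [hd, hp, hq] using this
  refine ⟨by simpa [hq0] using h, hq0⟩

/-- Let `Y i` be anticommuting operators and `d i` contractions dual to them, and let the `a i`
form a regular sequence in every order. Then every cycle of the Koszul differential on
`koszulSpan L` is a boundary plus a multiple of the top element, and a multiple `c` of the top
element is a boundary exactly if `c` lies in the ideal of the `a i`. Both statements are proved
together, by induction on the list: adding a generator replaces the complex by the cone of the
multiplication by `a i`. -/
theorem koszul_exact (hYY : ∀ i j z, Y i (Y j z) = -Y j (Y i z))
    (hsq : ∀ i z, Y i (Y i z) = 0)
    (hdY : ∀ i j z, i ≠ j → d i (Y j z) = -Y j (d i z))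
    (hd : ∀ i z, d i (Y i z) = z - Y i (d i z))
    (hvac : ∀ i, d i vac = 0) (hinj : ∀ c : A, c • vac = 0 → c = 0)
    (hreg : ∀ (i : ι) (L : List ι), i ∉ L → ∀ c, a i * c ∈ Ideal.span (a '' {j | j ∈ L}) →
      c ∈ Ideal.span (a '' {j | j ∈ L}))
    (L : List ι) (hL : L.Nodup) :
    (∀ z ∈ koszulSpan Y vac L, koszulMap Y a L z = 0 →
      ∃ w ∈ koszulSpan Y vac L, ∃ c : A, z = koszulMap Y a L w + c • koszulTop Y vac L) ∧
    (∀ c : A, c ∈ Ideal.span (a '' {j | j ∈ L}) ↔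
      ∃ w ∈ koszulSpan Y vac L, c • koszulTop Y vac L = koszulMap Y a L w) := by
  induction L with
  | nil =>
    refine ⟨fun z hz _ => ⟨0, zero_mem _, ?_⟩, fun c => ?_⟩
    · obtain ⟨c, rfl⟩ := Submodule.mem_span_singleton.1 hz
      exact ⟨c, by simp [koszulTop]⟩
    · simp only [List.not_mem_nil, Set.ofPred_false, Set.image_empty, Ideal.span_empty,
        Ideal.mem_bot]
      constructor
      · rintro rfl
        exact ⟨0, zero_mem _, by simp⟩
      · rintro ⟨w, -, hw⟩
        exact hinj c (by simpa [koszulMap, koszulTop] using hw)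
  | cons i L ih =>
    obtain ⟨hi, hL'⟩ := List.nodup_cons.1 hL
    obtain ⟨hE, hF⟩ := ih hL'
    have kill : ∀ {z}, z ∈ koszulSpan Y vac L → d i z = 0 :=
      fun hz => contract_koszulSpan hdY hvac hi hz
    have killK : ∀ {z}, z ∈ koszulSpan Y vac L → d i (koszulMap Y a L z) = 0 := fun hz => by
      rw [contract_koszulMap hdY hi, kill hz, map_zero, neg_zero]
    have expand : ∀ u v, koszulMap Y a (i :: L) (u + Y i v) =
        koszulMap Y a L u + Y i (a i • u - koszulMap Y a L v) := fun u v => by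
      rw [koszulMap_cons, map_add, map_add, hsq, map_sub, apply_koszulMap hYY, map_smul]
      module
    refine ⟨fun z hz hKz => ?_, fun c => ?_⟩
    · obtain ⟨u, hu, v, hv, rfl⟩ := mem_koszulSpan_cons.1 hz
      rw [expand] at hKz
      obtain ⟨h1, h2⟩ := eq_zero_of_add_apply_eq_zero hd (killK hu)
        (by rw [map_sub, map_smul, kill hu, killK hv, smul_zero, sub_zero]) hKz
      obtain ⟨w, hw, c, hwc⟩ := hE u hu h1
      -- `a i` is regular modulo the previous elements, so the top coefficient `c` of `u` vanishes
      have hc : c ∈ Ideal.span (a '' {j | j ∈ L}) := by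
        refine hreg i L hi c ((hF _).2 ⟨v - a i • w, sub_mem hv (Submodule.smul_mem _ _ hw), ?_⟩)
        rw [map_sub, map_smul, ← sub_eq_zero.1 h2, hwc, mul_smul]
        module
      -- Now `u` is a boundary, and `v` is one up to `a i • (w + w')` and a multiple of the top
      -- element.
      obtain ⟨w', hw', hcw'⟩ := (hF c).1 hc
      have hu' : u = koszulMap Y a L (w + w') := by rw [hwc, hcw', map_add]
      obtain ⟨x, hx, b, hxb⟩ := hE (v - a i • (w + w'))
        (sub_mem hv (Submodule.smul_mem _ _ (add_mem hw hw'))) (by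
          rw [map_sub, map_smul, ← hu', sub_eq_zero, sub_eq_zero.1 h2])
      refine ⟨(w + w') + Y i (-x), mem_koszulSpan_cons.2 ⟨_, add_mem hw hw', _, neg_mem hx, rfl⟩,
        b, ?_⟩
      rw [expand, ← hu', koszulTop, ← map_smul (Y i) b, add_assoc, ← map_add, map_neg,
        sub_neg_eq_add, add_assoc, ← hxb, add_sub_cancel]
    · have hset : a '' {j | j ∈ i :: L} = insert (a i) (a '' {j | j ∈ L}) := by
        ext x; simp [eq_comm]
      rw [hset, Ideal.mem_span_insert]
      constructor
      · rintro ⟨b, e, he, rfl⟩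
        obtain ⟨w, hw, hew⟩ := (hF e).1 he
        refine ⟨b • koszulTop Y vac L + Y i (-w), mem_koszulSpan_cons.2
          ⟨_, Submodule.smul_mem _ _ (koszulTop_mem L), _, neg_mem hw, rfl⟩, ?_⟩
        rw [expand, map_smul, koszulMap_koszulTop hYY hsq L, smul_zero, zero_add, map_neg, ← hew,
          koszulTop, ← map_smul (Y i) (b * a i + e)]
        congr 1
        module
      · rintro ⟨w, hw, hcw⟩
        obtain ⟨p, hp, q, hq, rfl⟩ := mem_koszulSpan_cons.1 hw
        rw [expand] at hcw
        obtain ⟨h1, h2⟩ := eq_zero_of_add_apply_eq_zero hd (p := koszulMap Y a L p)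
          (q := a i • p - koszulMap Y a L q - c • koszulTop Y vac L) (killK hp)
          (by simp [kill hp, killK hq, kill (koszulTop_mem L)])
          (by rw [map_sub (Y i) _ (c • _), map_smul (Y i) c, ← add_sub_assoc, ← hcw, koszulTop,
            sub_self])
        obtain ⟨r, hr, b, hrb⟩ := hE p hp h1
        refine ⟨b, c - b * a i, (hF _).2 ⟨a i • r - q, sub_mem (Submodule.smul_mem _ _ hr) hq, ?_⟩,
          by ring⟩
        rw [map_sub, map_smul, sub_smul, ← sub_eq_zero.1 h2, mul_comm, mul_smul,
          ← add_sub_cancel_left (koszulMap Y a L r) (b • koszulTop Y vac L), ← hrb]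
        module

end AbstractKoszul

/-! ### The Koszul complex on the forms `γ_1 + ⋯ + 2γ_i + ⋯ + γ_n` -/

section Koszul

variable (R : Type*) [CommRing R] (n : ℕ)

/-- The underlying module of the Koszul complex, `R[γ_1, …, γ_n] ⊗ Λ(y_1, …, y_n)`. The polynomial
ring comes first, so that `Kos` is a module over it. -/
abbrev Kos : Type _ := Pol R n ⊗[R] Lam R n

variable {n}

/-- Left multiplication by the exterior generator `y i`. -/
def yMul (i : Fin n) : Module.End (Pol R n) (Kos R n) :=
  (LinearMap.mulLeft R (y R i)).baseChange (Pol R n)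

/-- Contraction with the coordinate form dual to `y i`. -/
def yContract (i : Fin n) : Module.End (Pol R n) (Kos R n) :=
  (CliffordAlgebra.contractLeft (Q := (0 : QuadraticForm R (Fin n → R)))
    (LinearMap.proj i)).baseChange (Pol R n)

/-- The coefficient `(-1)^i γ̃_i` of `y i` in `D(x_2)`. -/
def gammaSigned (i : Fin n) : Pol R n := (-1) ^ (i : ℕ) * gammaTilde R i

variable (n)

/-- The Koszul differential: multiplication by `∑ (-1)^i γ̃_i y_i`, the value of `D` on `x_2`. -/
def kosMap : Module.End (Pol R n) (Kos R n) :=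
  koszulMap (yMul R) (gammaSigned R) (List.finRange n)

/-- The ideal generated by the linear forms `γ̃_i`. -/
def gammaIdeal : Ideal (Pol R n) := Ideal.span (Set.range (gammaTilde R))

variable {n}

theorem yMul_tmul (i : Fin n) (P : Pol R n) (l : Lam R n) :
    yMul R i (P ⊗ₜ l) = P ⊗ₜ (y R i * l) := rfl

theorem yContract_tmul (i : Fin n) (P : Pol R n) (l : Lam R n) :
    yContract R i (P ⊗ₜ l) = P ⊗ₜ (CliffordAlgebra.contractLeft
      (Q := (0 : QuadraticForm R (Fin n → R))) (LinearMap.proj i) l) := rfl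

theorem kosMap_tmul (P : Pol R n) (l : Lam R n) :
    kosMap R n (P ⊗ₜ l) =
      ∑ i : Fin n, (-1 : R) ^ (i : ℕ) • ((gammaTilde R i * P) ⊗ₜ[R] (y R i * l)) := by
  have h : kosMap R n = ∑ i : Fin n, gammaSigned R i • yMul R i := by
    rw [kosMap, koszulMap, ← List.ofFn_eq_map, List.sum_ofFn]
  rw [h, LinearMap.sum_apply]
  refine Finset.sum_congr rfl fun i _ => ?_
  rw [LinearMap.smul_apply, yMul_tmul, TensorProduct.smul_tmul', TensorProduct.smul_tmul',
    gammaSigned, smul_eq_mul, mul_assoc]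
  congr 1
  rw [Algebra.smul_def]
  simp

theorem y_mul_y (i j : Fin n) : y R i * y R j = -(y R j * y R i) :=
  eq_neg_iff_add_eq_zero.2 (ExteriorAlgebra.ι_add_mul_swap _ _)

theorem yMul_yMul (i j : Fin n) (z : Kos R n) :
    yMul R i (yMul R j z) = -yMul R j (yMul R i z) := by
  induction z using TensorProduct.induction_on with
  | zero => simp
  | add u v hu hv => simp only [map_add, hu, hv, neg_add]
  | tmul P l =>
    simp only [yMul_tmul, ← mul_assoc]
    rw [y_mul_y, neg_mul, TensorProduct.tmul_neg]

theorem yMul_self (i : Fin n) (z : Kos R n) : yMul R i (yMul R i z) = 0 := by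
  induction z using TensorProduct.induction_on with
  | zero => simp
  | add u v hu hv => simp only [map_add, hu, hv, add_zero]
  | tmul P l =>
    have : y R i * y R i = 0 := ExteriorAlgebra.ι_sq_zero _
    simp [yMul_tmul, ← mul_assoc, this]

theorem yContract_yMul (i j : Fin n) (z : Kos R n) :
    yContract R i (yMul R j z) =
      (if i = j then z else 0) - yMul R j (yContract R i z) := by
  induction z using TensorProduct.induction_on with
  | zero => simp
  | add u v hu hv =>
    simp only [map_add, hu, hv]
    split_ifs <;> abel
  | tmul P l =>
    have h := CliffordAlgebra.contractLeft_ι_mul (Q := (0 : QuadraticForm R (Fin n → R)))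
      (LinearMap.proj i) (Pi.single j 1) l
    rw [yMul_tmul, yContract_tmul, yContract_tmul, yMul_tmul, y, ExteriorAlgebra.ι]
    refine (congrArg (P ⊗ₜ[R] ·) h).trans ?_
    rw [TensorProduct.tmul_sub]
    congr 1
    by_cases hij : i = j
    · subst hij; simp
    · simp [hij]

theorem yContract_vac (i : Fin n) : yContract R i ((1 : Pol R n) ⊗ₜ (1 : Lam R n)) = 0 := by
  rw [yContract_tmul]
  refine (congrArg ((1 : Pol R n) ⊗ₜ[R] ·) (CliffordAlgebra.contractLeft_one
    (Q := (0 : QuadraticForm R (Fin n → R))) _)).trans (TensorProduct.tmul_zero _ _)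

/-- The augmentation of `Λ` recovers `P` from `P ⊗ 1`. -/
theorem smul_vac_eq_zero (P : Pol R n) (h : P • ((1 : Pol R n) ⊗ₜ[R] (1 : Lam R n)) = 0) :
    P = 0 := by
  have h2 := congrArg (TensorProduct.lift ((LinearMap.mul R (Pol R n)).compl₂
    ((Algebra.linearMap R (Pol R n)) ∘ₗ
      (ExteriorAlgebra.algebraMapInv (R := R) (M := Fin n → R)).toLinearMap))) h
  simpa [TensorProduct.smul_tmul'] using h2

/-- The whole Koszul complex is generated from `1 ⊗ 1`: the left-hand side contains `1 ⊗ 1` and is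
stable under multiplication by all of `Λ`. -/
theorem koszulSpan_eq_top :
    koszulSpan (yMul R) ((1 : Pol R n) ⊗ₜ[R] (1 : Lam R n)) (List.finRange n) = ⊤ := by
  set W := koszulSpan (yMul R) ((1 : Pol R n) ⊗ₜ[R] (1 : Lam R n)) (List.finRange n)
  have h1 : ∀ L : List (Fin n), (1 : Pol R n) ⊗ₜ[R] (1 : Lam R n) ∈ koszulSpan (yMul R)
      ((1 : Pol R n) ⊗ₜ[R] (1 : Lam R n)) L := fun L => by
    induction L with
    | nil => exact Submodule.mem_span_singleton_self _
    | cons i L ih => exact Submodule.mem_sup_left ih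
  have key : ∀ l : Lam R n, ∀ w ∈ W, (LinearMap.mulLeft R l).baseChange (Pol R n) w ∈ W := by
    intro l
    induction l using ExteriorAlgebra.induction with
    | algebraMap r =>
      intro w hw
      have : LinearMap.mulLeft R (algebraMap R (Lam R n) r) = r • LinearMap.id := by
        ext x; simp [Algebra.smul_def]
      rw [this, LinearMap.baseChange_smul, LinearMap.smul_apply, LinearMap.baseChange_id]
      exact W.smul_of_tower_mem r hw
    | ι v =>
      intro w hw
      have hv : ExteriorAlgebra.ι R v = ∑ i, v i • y R i := by
        conv_lhs => rw [pi_eq_sum_univ' v]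
        simp [y]
      have : (LinearMap.mulLeft R (ExteriorAlgebra.ι R v)).baseChange (Pol R n) w
          = ∑ i, v i • yMul R i w := by
        rw [hv]
        clear hw
        induction w using TensorProduct.induction_on with
        | zero => simp
        | add u v hu hv => simp only [map_add, smul_add, Finset.sum_add_distrib, hu, hv]
        | tmul P l =>
          simp [yMul_tmul, Finset.sum_mul, TensorProduct.tmul_sum]
      rw [this]
      exact W.sum_mem fun i _ => W.smul_of_tower_mem _
        (apply_mem_koszulSpan (yMul_yMul R) (yMul_self R) (List.mem_finRange i) hw)
    | mul a b ha hb =>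
      intro w hw
      rw [LinearMap.mulLeft_mul, LinearMap.baseChange_comp]
      exact ha _ (hb _ hw)
    | add a b ha hb =>
      intro w hw
      have : LinearMap.mulLeft R (a + b) = LinearMap.mulLeft R a + LinearMap.mulLeft R b := by
        ext; simp [add_mul]
      rw [this, LinearMap.baseChange_add]
      exact W.add_mem (ha _ hw) (hb _ hw)
  rw [eq_top_iff]
  rintro z -
  induction z using TensorProduct.induction_on with
  | zero => exact zero_mem _
  | add u v hu hv => exact add_mem hu hv
  | tmul P l =>
    have := W.smul_mem P (key l _ (h1 _))
    simpa [TensorProduct.smul_tmul'] using this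

theorem kosMap_kosMap (z : Kos R n) : kosMap R n (kosMap R n z) = 0 :=
  koszulMap_koszulMap (yMul_yMul R) (yMul_self R) _ z

/-- The substitution used in `gammaTilde_regular` fixes `γ_1 + ⋯ + γ_n`. -/
theorem sum_gammaTilde_substitution (T : Finset (Fin n)) (i : Fin n) :
    ∑ j, (MvPolynomial.X j - (if j ∈ T then gammaTilde R j else 0) +
      (if j = i then ∑ k ∈ T, gammaTilde R k else 0)) = ∑ j, (MvPolynomial.X j : Pol R n) := by
  simp [Finset.sum_add_distrib, Finset.sum_sub_distrib]

/-- The forms `γ̃_i` are a regular sequence in every order. For `i ∉ T`, send `γ_j` to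
`γ_j - γ̃_j = -(γ_1 + ⋯ + γ_n)` for `j ∈ T` and `γ_i` to `γ_i + ∑_{k ∈ T} γ̃_k`, and fix the other
variables. This is the identity modulo the ideal of the `γ̃_j` with `j ∈ T`, kills that ideal, and
does not kill `γ̃_i`; as it takes values in a domain, `γ̃_i` is regular modulo the ideal. -/
theorem gammaTilde_regular [IsDomain R] [CharZero R] (T : Finset (Fin n)) (i : Fin n) (hi : i ∉ T)
    (c : Pol R n) (h : gammaTilde R i * c ∈ Ideal.span (gammaTilde R '' T)) :
    c ∈ Ideal.span (gammaTilde R '' T) := by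
  set I := Ideal.span (gammaTilde R '' (T : Set (Fin n)))
  set f : Fin n → Pol R n := fun j => MvPolynomial.X j - (if j ∈ T then gammaTilde R j else 0) +
      (if j = i then ∑ k ∈ T, gammaTilde R k else 0) with hf
  have hmem : ∀ j ∈ T, gammaTilde R j ∈ I := fun j hj => Ideal.subset_span ⟨j, hj, rfl⟩
  have hsum : ∑ k ∈ T, gammaTilde R k ∈ I := sum_mem hmem
  -- the substitution `f` is the identity modulo the ideal, and it kills the ideal
  have hρ : ∀ Q : Pol R n,
      Ideal.Quotient.mk I (MvPolynomial.aeval f Q) = Ideal.Quotient.mk I Q := by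
    intro Q
    have : (Ideal.Quotient.mkₐ R I).comp (MvPolynomial.aeval f) = Ideal.Quotient.mkₐ R I := by
      refine MvPolynomial.algHom_ext fun j => ?_
      simp only [AlgHom.comp_apply, MvPolynomial.aeval_X, Ideal.Quotient.mkₐ_eq_mk]
      refine Ideal.Quotient.eq.2 ?_
      have : f j - MvPolynomial.X j = -(if j ∈ T then gammaTilde R j else 0) +
          (if j = i then ∑ k ∈ T, gammaTilde R k else 0) := by simp only [hf]; ring
      rw [this]
      refine add_mem (neg_mem ?_) ?_
      · split_ifs with hj
        exacts [hmem j hj, zero_mem _]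
      · split_ifs
        exacts [hsum, zero_mem _]
    exact DFunLike.congr_fun this Q
  have hval : ∀ j, MvPolynomial.aeval f (gammaTilde R j) = (∑ k, MvPolynomial.X k) + f j := by
    intro j
    simp only [gammaTilde, map_add, map_sum, MvPolynomial.aeval_X]
    congr 1
    exact sum_gammaTilde_substitution R T i
  have hkill : I ≤ RingHom.ker (MvPolynomial.aeval (R := R) f) := by
    refine Ideal.span_le.2 ?_
    rintro _ ⟨j, hj, rfl⟩
    have hji : j ≠ i := by rintro rfl; exact hi hj
    have hj' : j ∈ T := hj
    rw [SetLike.mem_coe, RingHom.mem_ker, hval, hf]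
    simp [hj', hji, gammaTilde]
  have hne : MvPolynomial.aeval f (gammaTilde R i) ≠ 0 := by
    intro h0
    -- At `(1, …, 1)` the image of `γ̃_i` takes a positive integer value.
    have := congrArg (MvPolynomial.eval fun _ => (1 : R)) h0
    rw [hval] at this
    simp [hf, hi, gammaTilde] at this
    norm_cast at this
    omega
  have h0 : MvPolynomial.aeval f (gammaTilde R i) * MvPolynomial.aeval f c = 0 := by
    rw [← map_mul]
    exact hkill h
  have hc := (mul_eq_zero.1 h0).resolve_left hne
  rw [← Ideal.Quotient.eq_zero_iff_mem, ← hρ, hc, map_zero]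

theorem span_gammaSigned (S : Set (Fin n)) :
    Ideal.span (gammaSigned R '' S) = Ideal.span (gammaTilde R '' S) := by
  have hu : ∀ i : Fin n, gammaTilde R i = (-1) ^ (i : ℕ) * gammaSigned R i := fun i => by
    rw [gammaSigned, ← mul_assoc, ← mul_pow]; simp
  refine le_antisymm (Ideal.span_le.2 ?_) (Ideal.span_le.2 ?_)
  · rintro _ ⟨i, hi, rfl⟩
    exact Ideal.mul_mem_left _ _ (Ideal.subset_span ⟨i, hi, rfl⟩)
  · rintro _ ⟨i, hi, rfl⟩
    rw [hu]
    exact Ideal.mul_mem_left _ _ (Ideal.subset_span ⟨i, hi, rfl⟩)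

theorem yProd_eq_sort (I : Finset (Fin n)) : yProd R n I = (I.sort.map (y R)).prod := by
  rw [← Finset.listMap_orderEmbOfFin_finRange I rfl, yProd, List.ofFn_eq_map, List.map_map]
  rfl

theorem koszulTop_yMul (L : List (Fin n)) :
    koszulTop (yMul R) ((1 : Pol R n) ⊗ₜ[R] (1 : Lam R n)) L = 1 ⊗ₜ (L.map (y R)).prod := by
  induction L with
  | nil => simp [koszulTop]
  | cons i L ih => rw [koszulTop, ih, yMul_tmul, List.map_cons, List.prod_cons]

/-- Every Koszul cycle is a boundary up to a multiple of `y_1 ⋯ y_n`, and the multiples of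
`y_1 ⋯ y_n` that are boundaries are those by elements of the ideal of the `γ̃_i`. -/
theorem kosMap_exact [IsDomain R] [CharZero R] :
    (∀ z, kosMap R n z = 0 → ∃ w, ∃ c : Pol R n,
      z = kosMap R n w + c ⊗ₜ yProd R n Finset.univ) ∧
    (∀ c : Pol R n, c ∈ gammaIdeal R n ↔ ∃ w, c ⊗ₜ yProd R n Finset.univ = kosMap R n w) := by
  have htop : ∀ c : Pol R n, c • koszulTop (yMul R) ((1 : Pol R n) ⊗ₜ[R] (1 : Lam R n))
      (List.finRange n) = c ⊗ₜ yProd R n Finset.univ := fun c => by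
    rw [koszulTop_yMul, yProd_eq_sort, Fin.sort_univ, TensorProduct.smul_tmul', smul_eq_mul,
      mul_one]
  have hI : Ideal.span (gammaSigned R '' {j | j ∈ List.finRange n}) = gammaIdeal R n := by
    rw [span_gammaSigned, gammaIdeal, ← Set.image_univ]
    congr 2
    ext; simp
  have h := koszul_exact (d := yContract R) (a := gammaSigned R) (yMul_yMul R) (yMul_self R)
    (fun i j z hij => by rw [yContract_yMul, if_neg hij, zero_sub])
    (fun i z => by rw [yContract_yMul, if_pos rfl]) (yContract_vac R) (smul_vac_eq_zero R)
    (fun i L hi c hc => by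
      have hset : {j | j ∈ L} = (L.toFinset : Set (Fin n)) := by ext; simp
      rw [span_gammaSigned, hset] at hc ⊢
      refine gammaTilde_regular R _ i (by simpa using hi) c ?_
      have := Ideal.mul_mem_left _ ((-1) ^ (i : ℕ)) hc
      rwa [gammaSigned, ← mul_assoc, ← mul_assoc, ← mul_pow, neg_one_mul, neg_neg, one_pow,
        one_mul] at this)
    (List.finRange n) (List.nodup_finRange n)
  simp only [koszulSpan_eq_top, htop, hI, Submodule.mem_top, true_and, true_implies] at h
  exact h

end Koszul

/-! ### The monomial basis of the divided power algebra -/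

section DividedPowerBasis

variable (R : Type*) [CommRing R] (n : ℕ)

/-- The divided power monomials span over any ring. -/
theorem span_dpMonomial : Submodule.span R (Set.range (dpMonomial R n)) = ⊤ := by
  have hv : Submodule.span R (Set.range fun i : Fin n => (Pi.single i 1 : Fin n → R)) = ⊤ := by
    rw [← (Pi.basisFun R (Fin n)).span_eq]
    congr with i
    simp
  have h := DividedPowerAlgebra.submodule_span_prod_dp_eq_top hv
  suffices key : ∀ g : DividedPowerAlgebra R (Fin n → R), g ∈ Submodule.span R (Set.range
      fun k : Fin n →₀ ℕ => k.prod fun i k => DividedPowerAlgebra.dp R k (Pi.single i 1)) →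
      (show Gam R n from g) ∈ Submodule.span R (Set.range (dpMonomial R n)) from
    eq_top_iff.2 fun g _ => key g (h ▸ Submodule.mem_top)
  intro g hg
  induction hg using Submodule.span_induction with
  | zero => exact zero_mem _
  | add u v _ _ hu hv => exact add_mem hu hv
  | smul r u _ hu => exact Submodule.smul_mem _ r hu
  | mem g hg =>
    obtain ⟨c, rfl⟩ := hg
    have hc : (c.prod fun i k => DividedPowerAlgebra.dp R k (Pi.single i 1 : Fin n → R)) =
        ∏ i, DividedPowerAlgebra.dp R (c i) (Pi.single i 1 : Fin n → R) :=
      Finsupp.prod_fintype c _ fun i => DividedPowerAlgebra.dp_zero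
    beta_reduce
    rw [hc]
    exact Submodule.subset_span ⟨c, rfl⟩

variable [IsDomain R] [CharZero R]

/-- The map `v_k ↦ v^k / k!` from the divided power algebra to polynomials over the fraction
field. -/
def dpToPoly : Gam R n →ₐ[R] MvPolynomial (Fin n) (FractionRing R) :=
  have : CharZero (FractionRing R) := IsFractionRing.charZero R
  DividedPowerAlgebra.lift' (M := Fin n → R)
    (f := fun kv => ((kv.1.factorial : FractionRing R)⁻¹) •
      (∑ i, kv.2 i • (MvPolynomial.X i : MvPolynomial (Fin n) (FractionRing R))) ^ kv.1)
    (fun v => by simp)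
    (fun k r v => by
      simp only [Pi.smul_apply, smul_eq_mul, mul_smul, ← Finset.smul_sum, smul_pow]
      rw [smul_comm])
    (fun k l v => by
      rw [smul_mul_smul_comm, ← pow_add, ← Nat.cast_smul_eq_nsmul (FractionRing R), smul_smul]
      congr 1
      have := Nat.add_choose_mul_factorial_mul_factorial k l
      rw [← Nat.choose_symm_add] at this
      have h1 : (k.factorial : FractionRing R) ≠ 0 := Nat.cast_ne_zero.2 k.factorial_ne_zero
      have h2 : (l.factorial : FractionRing R) ≠ 0 := Nat.cast_ne_zero.2 l.factorial_ne_zero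
      have h3 : ((k + l).factorial : FractionRing R) ≠ 0 :=
        Nat.cast_ne_zero.2 (k + l).factorial_ne_zero
      field_simp
      rw [← this]
      push_cast
      ring)
    (fun k u v => by
      simp only [Pi.add_apply, add_smul, Finset.sum_add_distrib]
      rw [(Commute.all _ _).add_pow', Finset.smul_sum]
      refine Finset.sum_congr rfl fun x hx => ?_
      obtain rfl := Finset.HasAntidiagonal.mem_antidiagonal.1 hx
      rw [smul_mul_smul_comm, ← Nat.cast_smul_eq_nsmul (FractionRing R), smul_smul]
      congr 1
      have := Nat.add_choose_mul_factorial_mul_factorial x.1 x.2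
      rw [← Nat.choose_symm_add] at this
      have h1 : (x.1.factorial : FractionRing R) ≠ 0 := Nat.cast_ne_zero.2 x.1.factorial_ne_zero
      have h2 : (x.2.factorial : FractionRing R) ≠ 0 := Nat.cast_ne_zero.2 x.2.factorial_ne_zero
      have h3 : ((x.1 + x.2).factorial : FractionRing R) ≠ 0 :=
        Nat.cast_ne_zero.2 (x.1 + x.2).factorial_ne_zero
      field_simp
      rw [← this]
      push_cast
      ring)

theorem dpToPoly_xdp (i : Fin n) (k : ℕ) : dpToPoly R n (xdp R i k) =
    ((k.factorial : FractionRing R)⁻¹) • MvPolynomial.X i ^ k := by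
  have h : dpToPoly R n (xdp R i k) = ((k.factorial : FractionRing R)⁻¹) •
      (∑ j, (Pi.single i 1 : Fin n → R) j •
        (MvPolynomial.X j : MvPolynomial (Fin n) (FractionRing R))) ^ k := by
    unfold dpToPoly
    exact DividedPowerAlgebra.lift'_apply_dp ..
  simp [h, Pi.single_apply]

theorem dpToPoly_dpMonomial (c : Fin n → ℕ) : dpToPoly R n (dpMonomial R n c) =
    MvPolynomial.monomial (Finsupp.equivFunOnFinite.symm c)
      (∏ i, ((c i).factorial : FractionRing R)⁻¹) := by
  rw [dpMonomial, map_prod, MvPolynomial.monomial_eq]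
  simp only [dpToPoly_xdp, MvPolynomial.smul_eq_C_mul, Finset.prod_mul_distrib, map_prod]
  congr 1
  rw [Finsupp.prod_fintype _ _ (by simp)]
  rfl

/-- The images of the divided power monomials under `dpToPoly` are nonzero multiples of distinct
monomials. -/
theorem linearIndependent_dpMonomial : LinearIndependent R (dpMonomial R n) := by
  have : CharZero (FractionRing R) := IsFractionRing.charZero R
  refine LinearIndependent.of_comp (dpToPoly R n).toLinearMap ?_
  rw [linearIndependent_iff']
  intro s g hg c hc
  have h := congrArg (MvPolynomial.coeff (Finsupp.equivFunOnFinite.symm c)) hg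
  simp only [Function.comp_apply, AlgHom.toLinearMap_apply, dpToPoly_dpMonomial,
    MvPolynomial.coeff_sum, MvPolynomial.coeff_smul, MvPolynomial.coeff_monomial,
    EmbeddingLike.apply_eq_iff_eq, smul_ite, smul_zero, MvPolynomial.coeff_zero,
    Finset.sum_ite_eq', hc, if_true] at h
  refine (smul_eq_zero.1 h).resolve_right (Finset.prod_ne_zero_iff.2 fun i _ => ?_)
  exact inv_ne_zero (Nat.cast_ne_zero.2 (c i).factorial_ne_zero)

/-- The basis of `Γ[x_2, …, x_{2n}]` formed by the divided power monomials. -/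
def dpBasis : Module.Basis (Fin n → ℕ) R (Gam R n) :=
  Module.Basis.mk (linearIndependent_dpMonomial R n) (span_dpMonomial R n).ge

theorem dpBasis_apply (c : Fin n → ℕ) : dpBasis R n c = dpMonomial R n c :=
  Module.Basis.mk_apply _ _ _

end DividedPowerBasis

/-! ### The differential on the coefficients of the divided power monomials -/

section Components

variable (R : Type*) [CommRing R] (n : ℕ)

/-- The map `P ⊗ l ↦ (X ⊗ l) ⊗ P` to `Ē`, where `X = dpMonomial c`. -/
def kosEmbed (c : Fin n → ℕ) : Kos R n →ₗ[R] Ebar R n :=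
  TensorProduct.map (TensorProduct.mk R (Gam R n) (Lam R n) (dpMonomial R n c)) LinearMap.id ∘ₗ
    (TensorProduct.comm R (Pol R n) (Lam R n)).toLinearMap

theorem kosEmbed_tmul (c : Fin n → ℕ) (P : Pol R n) (l : Lam R n) :
    kosEmbed R n c (P ⊗ₜ l) = (dpMonomial R n c ⊗ₜ l) ⊗ₜ P := rfl

variable {n} in
/-- The exponents of the monomial whose derivative with respect to `x_2` is `dpMonomial c`. -/
def raise [NeZero n] (c : Fin n → ℕ) : Fin n → ℕ := Function.update c 0 (c 0 + 1)

variable {n} in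
theorem raise_injective [NeZero n] : Function.Injective (raise (n := n)) := by
  intro c c' h
  funext i
  have h0 := congrFun h i
  by_cases hi : i = 0
  · subst hi
    simpa [raise] using h0
  · simpa [raise, hi] using h0

variable {n} in
theorem exists_raise [NeZero n] (c : Fin n → ℕ) (h : c 0 ≠ 0) : ∃ c', c = raise c' := by
  refine ⟨Function.update c 0 (c 0 - 1), ?_⟩
  have : c 0 - 1 + 1 = c 0 := by omega
  simp [raise, this]

theorem xdp_zero (i : Fin n) : xdp R i 0 = 1 := DividedPowerAlgebra.dp_zero

theorem dpMonomial_eq_mul [NeZero n] (c : Fin n → ℕ) :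
    dpMonomial R n c = xdp R 0 (c 0) * ∏ i ∈ Finset.univ.erase 0, xdp R i (c i) :=
  (Finset.mul_prod_erase _ _ (Finset.mem_univ 0)).symm

theorem dpMonomial_update [NeZero n] (c : Fin n → ℕ) (m : ℕ) :
    dpMonomial R n (Function.update c 0 m) =
      xdp R 0 m * ∏ i ∈ Finset.univ.erase 0, xdp R i (c i) := by
  rw [dpMonomial_eq_mul, Function.update_self]
  congr 1
  refine Finset.prod_congr rfl fun i hi => ?_
  rw [Function.update_of_ne (Finset.ne_of_mem_erase hi)]

theorem xdp_mul_dpMonomial [NeZero n] (c : Fin n → ℕ) (h : c 0 = 0) (m : ℕ) :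
    xdp R 0 m * dpMonomial R n c = dpMonomial R n (Function.update c 0 m) := by
  rw [dpMonomial_update, dpMonomial_eq_mul, h, xdp_zero, one_mul]

theorem dx2_mul [NeZero n] (a b : Gam R n) : dx2 R n (a * b) = dx2 R n a * b + a * dx2 R n b :=
  dpDeriv_mul _ _ _

theorem dx2_prod_xdp [NeZero n] (c : Fin n → ℕ) (s : Finset (Fin n)) (hs : 0 ∉ s) :
    dx2 R n (∏ i ∈ s, xdp R i (c i)) = 0 := by
  induction s using Finset.induction_on with
  | empty => simp [dx2_one]
  | insert i s hi ih =>
    rw [Finset.prod_insert hi, dx2_mul, ih (fun h => hs (Finset.mem_insert_of_mem h)),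
      dx2_xdp_of_ne R n i (by rintro rfl; simp at hs), zero_mul, mul_zero, add_zero]

theorem dx2_dpMonomial_raise [NeZero n] (c : Fin n → ℕ) :
    dx2 R n (dpMonomial R n (raise c)) = dpMonomial R n c := by
  rw [raise, dpMonomial_update, dx2_mul, dx2_xdp_succ, dx2_prod_xdp R n c _ (by simp), mul_zero,
    add_zero, ← dpMonomial_eq_mul]

theorem dx2_dpMonomial_of_eq_zero [NeZero n] (c : Fin n → ℕ) (h : c 0 = 0) :
    dx2 R n (dpMonomial R n c) = 0 := by
  rw [dpMonomial_eq_mul, h, xdp_zero, one_mul, dx2_prod_xdp R n c _ (by simp)]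

theorem D_kosEmbed_raise [NeZero n] (c : Fin n → ℕ) (z : Kos R n) :
    D R n (kosEmbed R n (raise c) z) = kosEmbed R n c (kosMap R n z) := by
  induction z using TensorProduct.induction_on with
  | zero => simp
  | add u v hu hv => simp only [map_add, hu, hv]
  | tmul P l =>
    simp only [kosEmbed_tmul, D_tmul, dx2_dpMonomial_raise, kosMap_tmul, map_sum, map_smul]

theorem D_kosEmbed_of_eq_zero [NeZero n] (c : Fin n → ℕ) (h : c 0 = 0) (z : Kos R n) :
    D R n (kosEmbed R n c z) = 0 := by
  induction z using TensorProduct.induction_on with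
  | zero => simp
  | add u v hu hv => simp only [map_add, hu, hv, add_zero]
  | tmul P l =>
    simp [kosEmbed_tmul, D_tmul, dx2_dpMonomial_of_eq_zero R n c h]

variable [IsDomain R] [CharZero R]

/-- The coefficient of the divided power monomial `dpMonomial c` in an element of `Ē`. -/
def kosCoord (c : Fin n → ℕ) : Ebar R n →ₗ[R] Kos R n :=
  (TensorProduct.comm R (Lam R n) (Pol R n)).toLinearMap ∘ₗ
    TensorProduct.map ((TensorProduct.lid R (Lam R n)).toLinearMap ∘ₗ
      TensorProduct.map ((dpBasis R n).coord c) LinearMap.id) LinearMap.id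

theorem kosCoord_tmul (c : Fin n → ℕ) (g : Gam R n) (l : Lam R n) (P : Pol R n) :
    kosCoord R n c ((g ⊗ₜ l) ⊗ₜ P) = (dpBasis R n).coord c g • P ⊗ₜ l := by
  simp [kosCoord, TensorProduct.smul_tmul]

theorem coord_dpMonomial (c c' : Fin n → ℕ) :
    (dpBasis R n).coord c (dpMonomial R n c') = if c' = c then 1 else 0 := by
  rw [← dpBasis_apply, Module.Basis.coord_apply, Module.Basis.repr_self, Finsupp.single_apply]

theorem kosCoord_kosEmbed_self (c : Fin n → ℕ) (z : Kos R n) :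
    kosCoord R n c (kosEmbed R n c z) = z := by
  induction z using TensorProduct.induction_on with
  | zero => simp
  | add u v hu hv => simp only [map_add, hu, hv]
  | tmul P l => rw [kosEmbed_tmul, kosCoord_tmul, coord_dpMonomial, if_pos rfl, one_smul]

theorem kosEmbed_injective (c : Fin n → ℕ) : Function.Injective (kosEmbed R n c) :=
  Function.LeftInverse.injective (kosCoord_kosEmbed_self R n c)

theorem kosCoord_kosEmbed_of_ne {c c' : Fin n → ℕ} (h : c' ≠ c) (z : Kos R n) :
    kosCoord R n c (kosEmbed R n c' z) = 0 := by
  induction z using TensorProduct.induction_on with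
  | zero => simp
  | add u v hu hv => simp only [map_add, hu, hv, add_zero]
  | tmul P l => rw [kosEmbed_tmul, kosCoord_tmul, coord_dpMonomial, if_neg h, zero_smul]

theorem coord_dx2 [NeZero n] (c : Fin n → ℕ) (g : Gam R n) :
    (dpBasis R n).coord c (dx2 R n g) = (dpBasis R n).coord (raise c) g := by
  have : (dpBasis R n).coord c ∘ₗ dx2 R n = (dpBasis R n).coord (raise c) := by
    refine (dpBasis R n).ext fun c' => ?_
    rw [LinearMap.comp_apply, dpBasis_apply, coord_dpMonomial]
    by_cases h : c' 0 = 0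
    · rw [dx2_dpMonomial_of_eq_zero R n c' h, map_zero, if_neg]
      rintro rfl
      simp [raise] at h
    · obtain ⟨c', rfl⟩ := exists_raise c' h
      simp only [dx2_dpMonomial_raise, coord_dpMonomial, raise_injective.eq_iff]
  exact DFunLike.congr_fun this g

/-- On coefficients of divided power monomials, `D` shifts the exponent of `x_2` and applies the
Koszul differential. -/
theorem kosCoord_D [NeZero n] (c : Fin n → ℕ) (e : Ebar R n) :
    kosCoord R n c (D R n e) = kosMap R n (kosCoord R n (raise c) e) := by
  have : kosCoord R n c ∘ₗ D R n =
      (kosMap R n).restrictScalars R ∘ₗ kosCoord R n (raise c) := by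
    refine TensorProduct.ext_threefold fun g l P => ?_
    simp only [LinearMap.comp_apply, D_tmul, map_sum, map_smul, kosCoord_tmul, coord_dx2,
      LinearMap.restrictScalars_apply, kosMap_tmul, Finset.smul_sum]
    refine Finset.sum_congr rfl fun i _ => smul_comm _ _ _
  exact DFunLike.congr_fun this e

theorem iSup_range_kosEmbed : ⨆ c, LinearMap.range (kosEmbed R n c) = ⊤ := by
  rw [eq_top_iff]
  rintro e -
  induction e using TensorProduct.induction_on with
  | zero => exact zero_mem _
  | add u v hu hv => exact add_mem hu hv
  | tmul u P =>
  induction u using TensorProduct.induction_on with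
  | zero => simp
  | add u v hu hv => rw [TensorProduct.add_tmul]; exact add_mem hu hv
  | tmul g l =>
  induction (dpBasis R n).mem_span g using Submodule.span_induction with
  | zero => simp
  | add u v _ _ hu hv => rw [TensorProduct.add_tmul, TensorProduct.add_tmul]; exact add_mem hu hv
  | smul r u _ hu =>
    rw [← TensorProduct.smul_tmul', ← TensorProduct.smul_tmul']
    exact Submodule.smul_mem _ r hu
  | mem g hg =>
    obtain ⟨c, rfl⟩ := hg
    rw [dpBasis_apply]
    exact Submodule.mem_iSup_of_mem c ⟨P ⊗ₜ l, rfl⟩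

end Components

/-! ### Homology of a complex cut by commuting projections -/

section HomologyDecomposition

variable {R M ι : Type*} [CommRing R] [AddCommGroup M] [Module R M]

/-- Let a module with an endomorphism `δ` be the sum of the ranges of orthogonal projections that
preserve the kernel and the image of `δ`. Then `ker δ / im δ` is the internal direct sum of the
groups of classes of cycles in these ranges. The projections need not commute with `δ`: for a
homogeneous `δ` of nonzero degree they commute only up to a shift of the index. -/
theorem isInternal_homology [DecidableEq ι] (δ : M →ₗ[R] M) (π : ι → M →ₗ[R] M)
    (hidem : ∀ i x, π i (π i x) = π i x) (horth : ∀ i j x, i ≠ j → π i (π j x) = 0)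
    (htop : ⨆ i, LinearMap.range (π i) = ⊤)
    (hker : ∀ i x, δ x = 0 → δ (π i x) = 0)
    (hran : ∀ i x, π i (δ x) ∈ LinearMap.range δ) :
    DirectSum.IsInternal fun i =>
      ((LinearMap.range (π i)).submoduleOf (LinearMap.ker δ)).map
        ((LinearMap.range δ).submoduleOf (LinearMap.ker δ)).mkQ := by
  rw [DirectSum.isInternal_submodule_iff_iSupIndep_and_iSup_eq_top]
  set Q := (LinearMap.range δ).submoduleOf (LinearMap.ker δ)
  -- the endomorphism of the homology induced by `π i`
  let ρ : ∀ i, (LinearMap.ker δ ⧸ Q) →ₗ[R] (LinearMap.ker δ ⧸ Q) := fun i =>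
    Q.mapQ Q ((π i).restrict fun x hx => hker i x hx) (by
      rintro ⟨x, hx⟩ ⟨w, hw⟩
      change π i x ∈ LinearMap.range δ
      obtain rfl : δ w = x := hw
      exact hran i w)
  have hρ : ∀ i (z : LinearMap.ker δ),
      ρ i (Q.mkQ z) = Q.mkQ ⟨π i z, hker i z z.2⟩ := fun i z => rfl
  constructor
  · intro i
    rw [Submodule.disjoint_def]
    intro h hi hj
    have h1 : ρ i h = h := by
      obtain ⟨⟨z, hz⟩, ⟨x, hx⟩, rfl⟩ := hi
      rw [hρ]
      congr 2
      obtain rfl : π i x = z := hx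
      exact hidem i x
    have h2 : (⨆ j, ⨆ _ : j ≠ i, ((LinearMap.range (π j)).submoduleOf (LinearMap.ker δ)).map
        Q.mkQ) ≤ LinearMap.ker (ρ i) := by
      refine iSup₂_le fun j hji => ?_
      rintro _ ⟨⟨z, hz⟩, ⟨x, hx⟩, rfl⟩
      rw [LinearMap.mem_ker, hρ]
      obtain rfl : π j x = z := hx
      have : (⟨π i (π j x), hker i _ hz⟩ : LinearMap.ker δ) = 0 :=
        Subtype.ext (horth i j x hji.symm)
      rw [this, map_zero]
    rw [← h1]
    exact h2 hj
  · rw [eq_top_iff]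
    rintro h -
    obtain ⟨⟨z, hz⟩, rfl⟩ := Q.mkQ_surjective h
    obtain ⟨f, hf, hfz⟩ := (Submodule.mem_iSup_iff_exists_finsupp _ z).1
      (htop ▸ Submodule.mem_top : z ∈ ⨆ i, LinearMap.range (π i))
    have hcomp : ∀ j, π j z = f j := fun j => by
      rw [← hfz, Finsupp.sum, map_sum, Finset.sum_eq_single j]
      · obtain ⟨x, hx⟩ := hf j
        rw [← hx, hidem]
      · intro i _ hij
        obtain ⟨x, hx⟩ := hf i
        rw [← hx, horth _ _ _ hij.symm]
      · intro hj
        rw [Finsupp.notMem_support_iff.1 hj, map_zero]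
    have hsum : (⟨z, hz⟩ : LinearMap.ker δ) =
        ∑ j ∈ f.support, ⟨π j z, hker j z hz⟩ := by
      refine Subtype.ext ?_
      rw [AddSubmonoidClass.coe_finsetSum]
      simp only [hcomp]
      exact hfz.symm
    rw [hsum, map_sum]
    exact sum_mem fun j _ => Submodule.mem_iSup_of_mem j ⟨_, ⟨z, rfl⟩, rfl⟩

end HomologyDecomposition

/-! ### Projections of a graded algebra -/

section GradedProjections

variable {R A : Type*} [CommRing R] [Ring A] [Algebra R A] (𝒜 : ℕ → Submodule R A)
  [GradedAlgebra 𝒜]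

theorem proj_mul_of_mem_one {a : A} (ha : a ∈ 𝒜 1) (k : ℕ) (b : A) :
    GradedAlgebra.proj 𝒜 (k + 1) (a * b) = a * GradedAlgebra.proj 𝒜 k b := by
  rw [add_comm, GradedAlgebra.proj_apply, GradedAlgebra.proj_apply]
  exact DirectSum.coe_decompose_mul_add_of_left_mem 𝒜 ha

theorem proj_zero_mul_of_mem_one {a : A} (ha : a ∈ 𝒜 1) (b : A) :
    GradedAlgebra.proj 𝒜 0 (a * b) = 0 := by
  rw [GradedAlgebra.proj_apply]
  exact DirectSum.coe_decompose_mul_of_left_mem_of_not_le 𝒜 ha (by omega)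

theorem proj_of_mem {k : ℕ} {a : A} (ha : a ∈ 𝒜 k) : GradedAlgebra.proj 𝒜 k a = a :=
  DirectSum.decompose_of_mem_same 𝒜 ha

theorem proj_mem (k : ℕ) (a : A) : GradedAlgebra.proj 𝒜 k a ∈ 𝒜 k :=
  (DirectSum.decompose 𝒜 a k).2

theorem proj_of_mem_ne {k l : ℕ} (h : l ≠ k) {a : A} (ha : a ∈ 𝒜 l) :
    GradedAlgebra.proj 𝒜 k a = 0 :=
  DirectSum.decompose_of_mem_ne 𝒜 ha h

end GradedProjections

/-! ### The bigrading of the Koszul complex -/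

section KosGrading

variable (R : Type*) [CommRing R] (n : ℕ)

/-- The basis of `Λ(y_1, …, y_n)` formed by the products `yProd I`. -/
def lamBasis : Module.Basis (Finset (Fin n)) R (Lam R n) :=
  (Pi.basisFun R (Fin n)).ExteriorAlgebra

theorem lamBasis_apply (I : Finset (Fin n)) : lamBasis R n I = yProd R n I := by
  rw [lamBasis, ExteriorAlgebra.basis_apply_ofCard _ rfl, ExteriorAlgebra.ιMulti_family,
    ExteriorAlgebra.ιMulti_apply, yProd]
  congr 1
  refine congrArg List.ofFn (funext fun k => ?_)
  simp only [Function.comp_apply, Pi.basisFun_apply, y]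
  rfl

theorem y_mem (i : Fin n) : y R i ∈ ⋀[R]^1 (Fin n → R) := by
  rw [ExteriorAlgebra.exteriorPower, pow_one]
  exact ⟨_, rfl⟩

theorem yProd_mem (I : Finset (Fin n)) : yProd R n I ∈ ⋀[R]^(I.card) (Fin n → R) := by
  rw [← lamBasis_apply, lamBasis, ExteriorAlgebra.basis_apply_ofCard _ rfl]
  exact ExteriorAlgebra.ιMulti_range R _ ⟨_, rfl⟩

theorem exteriorPower_eq_span (k : ℕ) :
    ⋀[R]^k (Fin n → R) =
      Submodule.span R {l | ∃ I : Finset (Fin n), I.card = k ∧ l = yProd R n I} := by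
  refine le_antisymm (fun l hl => ?_) (Submodule.span_le.2 ?_)
  · rw [← proj_of_mem (fun k => ⋀[R]^k (Fin n → R)) hl]
    clear hl
    induction (lamBasis R n).mem_span l using Submodule.span_induction with
    | zero => rw [map_zero]; exact zero_mem _
    | add u v _ _ hu hv => rw [map_add]; exact add_mem hu hv
    | smul r u _ hu => rw [map_smul]; exact Submodule.smul_mem _ r hu
    | mem l hl =>
      obtain ⟨I, rfl⟩ := hl
      rw [lamBasis_apply]
      by_cases hI : I.card = k
      · subst hI
        rw [proj_of_mem (fun k => ⋀[R]^k (Fin n → R)) (yProd_mem R n I)]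
        exact Submodule.subset_span ⟨I, rfl, rfl⟩
      · rw [proj_of_mem_ne (fun k => ⋀[R]^k (Fin n → R)) hI (yProd_mem R n I)]
        exact zero_mem _
  · rintro _ ⟨I, rfl, rfl⟩
    exact yProd_mem R n I

theorem gammaTilde_mem (i : Fin n) :
    gammaTilde R i ∈ MvPolynomial.homogeneousSubmodule (Fin n) R 1 :=
  (MvPolynomial.IsHomogeneous.sum _ _ _ fun k _ => MvPolynomial.isHomogeneous_X R k).add
    (MvPolynomial.isHomogeneous_X R i)

attribute [local instance] MvPolynomial.gradedAlgebra

/-- The projection of the Koszul complex to polynomial degree `p` and exterior degree `k`. -/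
def kosProj (p k : ℕ) : Kos R n →ₗ[R] Kos R n :=
  TensorProduct.map (GradedAlgebra.proj (MvPolynomial.homogeneousSubmodule (Fin n) R) p)
    (GradedAlgebra.proj (fun k => ⋀[R]^k (Fin n → R)) k)

/-- The part of the Koszul complex of polynomial degree `p` and exterior degree `k`. -/
def kosDeg (p k : ℕ) : Submodule R (Kos R n) := LinearMap.range (kosProj R n p k)

variable {n}

theorem kosProj_tmul_self {p k : ℕ} {P : Pol R n}
    (hP : P ∈ MvPolynomial.homogeneousSubmodule (Fin n) R p) {l : Lam R n}
    (hl : l ∈ ⋀[R]^k (Fin n → R)) : kosProj R n p k (P ⊗ₜ l) = P ⊗ₜ l := by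
  rw [kosProj, TensorProduct.map_tmul, proj_of_mem _ hP,
    proj_of_mem (fun k => ⋀[R]^k (Fin n → R)) hl]

theorem tmul_mem_kosDeg {p k : ℕ} {P : Pol R n}
    (hP : P ∈ MvPolynomial.homogeneousSubmodule (Fin n) R p) {l : Lam R n}
    (hl : l ∈ ⋀[R]^k (Fin n → R)) : P ⊗ₜ l ∈ kosDeg R n p k :=
  ⟨_, kosProj_tmul_self R hP hl⟩

theorem kosDeg_eq_span (p k : ℕ) : kosDeg R n p k = Submodule.span R
    {z | ∃ P ∈ MvPolynomial.homogeneousSubmodule (Fin n) R p, ∃ l ∈ ⋀[R]^k (Fin n → R),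
      z = P ⊗ₜ l} := by
  refine le_antisymm ?_ (Submodule.span_le.2 ?_)
  · rintro _ ⟨z, rfl⟩
    induction z using TensorProduct.induction_on with
    | zero => simp
    | add u v hu hv => rw [map_add]; exact add_mem hu hv
    | tmul P l =>
      exact Submodule.subset_span ⟨_, proj_mem _ p P, _,
        proj_mem (fun k => ⋀[R]^k (Fin n → R)) k l, rfl⟩
  · rintro _ ⟨P, hP, l, hl, rfl⟩
    exact tmul_mem_kosDeg R hP hl

theorem kosProj_of_mem {p k : ℕ} {z : Kos R n} (hz : z ∈ kosDeg R n p k) :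
    kosProj R n p k z = z := by
  rw [kosDeg_eq_span] at hz
  induction hz using Submodule.span_induction with
  | zero => simp
  | add u v _ _ hu hv => rw [map_add, hu, hv]
  | smul r u _ hu => rw [map_smul, hu]
  | mem z hz =>
    obtain ⟨P, hP, l, hl, rfl⟩ := hz
    exact kosProj_tmul_self R hP hl

theorem kosProj_of_mem_of_ne {p k p' k' : ℕ} (h : (p, k) ≠ (p', k')) {z : Kos R n}
    (hz : z ∈ kosDeg R n p k) : kosProj R n p' k' z = 0 := by
  rw [kosDeg_eq_span] at hz
  induction hz using Submodule.span_induction with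
  | zero => simp
  | add u v _ _ hu hv => rw [map_add, hu, hv, add_zero]
  | smul r u _ hu => rw [map_smul, hu, smul_zero]
  | mem z hz =>
    obtain ⟨P, hP, l, hl, rfl⟩ := hz
    rw [kosProj, TensorProduct.map_tmul]
    by_cases hp : p = p'
    · have hk : k ≠ k' := fun hk => h (by rw [hp, hk])
      rw [proj_of_mem_ne (fun k => ⋀[R]^k (Fin n → R)) hk hl, TensorProduct.tmul_zero]
    · rw [proj_of_mem_ne _ hp hP, TensorProduct.zero_tmul]

theorem kosProj_succ_kosMap (p k : ℕ) (z : Kos R n) :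
    kosProj R n (p + 1) (k + 1) (kosMap R n z) = kosMap R n (kosProj R n p k z) := by
  induction z using TensorProduct.induction_on with
  | zero => simp
  | add u v hu hv => simp only [map_add, hu, hv]
  | tmul P l =>
    simp only [kosProj, TensorProduct.map_tmul, kosMap_tmul, map_sum, map_smul]
    refine Finset.sum_congr rfl fun i _ => ?_
    rw [proj_mul_of_mem_one _ (gammaTilde_mem R n i),
      proj_mul_of_mem_one (fun k => ⋀[R]^k (Fin n → R)) (y_mem R n i)]

theorem kosProj_kosMap_of_eq_zero (p k : ℕ) (h : p = 0 ∨ k = 0) (z : Kos R n) :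
    kosProj R n p k (kosMap R n z) = 0 := by
  induction z using TensorProduct.induction_on with
  | zero => simp
  | add u v hu hv => simp only [map_add, hu, hv, add_zero]
  | tmul P l =>
    simp only [kosProj, TensorProduct.map_tmul, kosMap_tmul, map_sum, map_smul]
    refine Finset.sum_eq_zero fun i _ => ?_
    rcases h with rfl | rfl
    · rw [proj_zero_mul_of_mem_one _ (gammaTilde_mem R n i), TensorProduct.zero_tmul, smul_zero]
    · rw [proj_zero_mul_of_mem_one (fun k => ⋀[R]^k (Fin n → R)) (y_mem R n i),
        TensorProduct.tmul_zero, smul_zero]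

theorem kosMap_mem_kosDeg {p k : ℕ} {z : Kos R n} (hz : z ∈ kosDeg R n p k) :
    kosMap R n z ∈ kosDeg R n (p + 1) (k + 1) :=
  ⟨kosMap R n z, by rw [kosProj_succ_kosMap, kosProj_of_mem R hz]⟩

theorem exteriorPower_eq_bot {k : ℕ} (h : n < k) : ⋀[R]^k (Fin n → R) = ⊥ := by
  rw [exteriorPower_eq_span, Submodule.span_eq_bot]
  rintro _ ⟨I, hI, -⟩
  have := I.card_le_univ
  rw [Fintype.card_fin] at this
  omega

theorem kosDeg_eq_bot (p : ℕ) {k : ℕ} (h : n < k) : kosDeg R n p k = ⊥ := by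
  rw [kosDeg_eq_span, Submodule.span_eq_bot]
  rintro _ ⟨P, -, l, hl, rfl⟩
  rw [exteriorPower_eq_bot R h, Submodule.mem_bot] at hl
  rw [hl, TensorProduct.tmul_zero]

/-- Exterior degrees are written `n - j` here, where `j` is the number of omitted generators. -/
theorem mem_iSup_kosDeg (z : Kos R n) : z ∈ ⨆ p : ℕ, ⨆ j : Fin (n + 1), kosDeg R n p (n - j) := by
  induction z using TensorProduct.induction_on with
  | zero => exact zero_mem _
  | add u v hu hv => exact add_mem hu hv
  | tmul P l =>
  induction (lamBasis R n).mem_span l using Submodule.span_induction with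
  | zero => simp
  | add u v _ _ hu hv => rw [TensorProduct.tmul_add]; exact add_mem hu hv
  | smul r u _ hu => rw [TensorProduct.tmul_smul]; exact Submodule.smul_mem _ r hu
  | mem l hl =>
  obtain ⟨I, rfl⟩ := hl
  rw [lamBasis_apply]
  have hI : I.card ≤ n := by simpa using I.card_le_univ
  induction P using DirectSum.Decomposition.inductionOn
    (MvPolynomial.homogeneousSubmodule (Fin n) R) with
  | zero => simp
  | add P Q hP hQ => rw [TensorProduct.add_tmul]; exact add_mem hP hQ
  | homogeneous P =>
    rename_i p
    refine Submodule.mem_iSup_of_mem p (Submodule.mem_iSup_of_mem ⟨n - I.card, by omega⟩ ?_)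
    refine tmul_mem_kosDeg R P.2 ?_
    have : n - (n - I.card) = I.card := by omega
    simp only [this]
    exact yProd_mem R n I

end KosGrading

/-! ### Decomposition of the homology -/

section Pieces

variable (R : Type*) [CommRing R] {n : ℕ} [NeZero n]

theorem dimX_update (c : Fin n → ℕ) (h : c 0 = 0) (m : ℕ) :
    dimX (Function.update c 0 m) = 2 * m + dimX c := by
  rw [dimX, dimX, ← Finset.add_sum_erase _ _ (Finset.mem_univ (0 : Fin n)),
    ← Finset.add_sum_erase (a := (0 : Fin n)) (s := Finset.univ)
      (f := fun i : Fin n => 2 * ((i : ℕ) + 1) * c i) (h := Finset.mem_univ _), h,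
    Function.update_self]
  have : ∀ i ∈ Finset.univ.erase (0 : Fin n), 2 * ((i : ℕ) + 1) * Function.update c 0 m i =
      2 * ((i : ℕ) + 1) * c i := fun i hi => by
    rw [Function.update_of_ne (Finset.ne_of_mem_erase hi)]
  rw [Finset.sum_congr rfl this]
  simp

theorem span_gens (m : ℕ) (c : Fin n → ℕ) (h : c 0 = 0) {j : ℕ} (hj : j ≤ n) :
    Submodule.span R (gens R n m c j) = (⋀[R]^(n - j) (Fin n → R)).map
      (TensorProduct.mk R (Gam R n) (Lam R n) (dpMonomial R n (Function.update c 0 m))) := by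
  rw [exteriorPower_eq_span, Submodule.map_span]
  congr 1
  ext b
  simp only [gens, xdp_mul_dpMonomial R n c h, Set.mem_ofPred_eq, Set.mem_image]
  constructor
  · rintro ⟨I, rfl, rfl⟩
    exact ⟨_, ⟨Iᶜ, by rw [Finset.card_compl, Fintype.card_fin], rfl⟩, rfl⟩
  · rintro ⟨_, ⟨I, hI, rfl⟩, rfl⟩
    refine ⟨Iᶜ, by rw [Finset.card_compl, Fintype.card_fin, hI]; omega, ?_⟩
    rw [yHat, compl_compl]
    rfl

/-- The piece `A^p ⊗ ⟨(x_2)_m X ŷ_{i_1,…,i_j}⟩` of `Ē` is a copy of the part of the Koszul complex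
of polynomial degree `p` and exterior degree `n - j`. -/
theorem piece_eq_map {p m j q : ℕ} (c : Fin n → ℕ) (h : c 0 = 0) (hj : j ≤ n)
    (hq : q = n - j + 2 * m + dimX c) :
    piece R n p q (gens R n m c j) =
      (kosDeg R n p (n - j)).map (kosEmbed R n (Function.update c 0 m)) := by
  have hle : Submodule.span R (gens R n m c j) ≤ fibDeg R n q := by
    rw [span_gens R m c h hj, exteriorPower_eq_span, Submodule.map_span]
    refine Submodule.span_mono ?_
    rintro _ ⟨_, ⟨I, hI, rfl⟩, rfl⟩
    exact ⟨_, I, by rw [dimX_update c h, hI, hq]; ring, rfl⟩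
  rw [piece, inf_eq_left.2 hle, span_gens R m c h hj, kosDeg_eq_span, Submodule.map_span]
  congr 1
  ext e
  constructor
  · rintro ⟨_, ⟨l, hl, rfl⟩, P, hP, rfl⟩
    exact ⟨P ⊗ₜ l, ⟨P, hP, l, hl, rfl⟩, rfl⟩
  · rintro ⟨_, ⟨P, hP, l, hl, rfl⟩, rfl⟩
    exact ⟨_, ⟨l, hl, rfl⟩, P, hP, rfl⟩

variable [IsDomain R] [CharZero R]

/-- A multiple of a divided power monomial is a boundary in `Ē` exactly if its coefficient is a
Koszul boundary, since every divided power monomial is the derivative of one with respect to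
`x_2`. -/
theorem kosEmbed_mem_range_D {c : Fin n → ℕ} {z : Kos R n} :
    kosEmbed R n c z ∈ LinearMap.range (D R n) ↔ z ∈ LinearMap.range (kosMap R n) := by
  constructor
  · rintro ⟨e, he⟩
    refine ⟨kosCoord R n (raise c) e, ?_⟩
    rw [← kosCoord_D, he, kosCoord_kosEmbed_self]
  · rintro ⟨w, rfl⟩
    exact ⟨_, D_kosEmbed_raise R n c w⟩

/-- If `x_2` does not occur in the monomial, then every coefficient gives a cycle; otherwise only
the Koszul cycles do. -/
theorem D_kosEmbed_eq_zero {c : Fin n → ℕ} {z : Kos R n} :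
    D R n (kosEmbed R n c z) = 0 ↔ c 0 = 0 ∨ kosMap R n z = 0 := by
  by_cases h : c 0 = 0
  · simp [h, D_kosEmbed_of_eq_zero]
  · obtain ⟨c, rfl⟩ := exists_raise c h
    rw [D_kosEmbed_raise, map_eq_zero_iff _ (kosEmbed_injective R n c)]
    simp [h]

/-- Computation of `H^*Ē^{p,q}((x_2)_m X ŷ_{i_1,…,i_j})`: if `f` maps `U` onto the coefficients
that give cycles, and `g` is a surjection from `U` whose kernel consists of the elements that `f`
sends to Koszul boundaries, then the group is isomorphic to the target of `g`. -/
theorem nonempty_HE_equiv {p m j q : ℕ} {c : Fin n → ℕ} (h : c 0 = 0) (hj : j ≤ n)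
    (hq : q = n - j + 2 * m + dimX c) {U X : Type*} [AddCommGroup U] [Module R U]
    [AddCommGroup X] [Module R X] (f : U →ₗ[R] Kos R n) (g : U →ₗ[R] X)
    (hg : Function.Surjective g) (hf : ∀ u, f u ∈ kosDeg R n p (n - j))
    (hcycle : ∀ u, m = 0 ∨ kosMap R n (f u) = 0)
    (hsurj : ∀ z ∈ kosDeg R n p (n - j), m = 0 ∨ kosMap R n z = 0 → ∃ u, f u = z)
    (hker : ∀ u, g u = 0 ↔ f u ∈ LinearMap.range (kosMap R n)) :
    Nonempty (HE R n p q (gens R n m c j) ≃ₗ[R] X) := by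
  set c' := Function.update c 0 m with hc'
  have hc0 : c' 0 = m := Function.update_self _ _ _
  set Q := (LinearMap.range (D R n)).submoduleOf (LinearMap.ker (D R n))
  let φ : U →ₗ[R] Homology R n := Q.mkQ ∘ₗ (kosEmbed R n c' ∘ₗ f).codRestrict
    (LinearMap.ker (D R n)) fun u => (D_kosEmbed_eq_zero R).2 (hc0 ▸ hcycle u)
  have hφ : LinearMap.range φ = HE R n p q (gens R n m c j) := by
    rw [HE, piece_eq_map R c h hj hq, ← hc']
    ext x
    constructor
    · rintro ⟨u, rfl⟩
      exact ⟨_, ⟨f u, hf u, rfl⟩, rfl⟩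
    · rintro ⟨⟨_, hz⟩, ⟨z, hzm, rfl⟩, rfl⟩
      have hz' := (D_kosEmbed_eq_zero R).1 (LinearMap.mem_ker.1 hz)
      rw [hc0] at hz'
      obtain ⟨u, rfl⟩ := hsurj z hzm hz'
      exact ⟨u, rfl⟩
  have hk : LinearMap.ker φ = LinearMap.ker g := by
    ext u
    rw [LinearMap.mem_ker, LinearMap.mem_ker, hker, LinearMap.comp_apply, Submodule.mkQ_apply,
      Submodule.Quotient.mk_eq_zero, ← kosEmbed_mem_range_D R (c := c')]
    rfl
  exact ⟨(LinearEquiv.ofEq _ _ hφ).symm ≪≫ₗ φ.quotKerEquivRange.symm ≪≫ₗ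
    Submodule.quotEquivOfEq _ _ hk ≪≫ₗ g.quotKerEquivOfSurjective hg⟩

variable (n)

/-- The projection of `Ē` to `A^p ⊗ ⟨(x_2)_m X ŷ_{i_1,…,i_j}⟩`, the index being `(p, m, j, c)` with
`X = dpMonomial c`. -/
def pieceProj (i : ℕ × ℕ × Fin (n + 1) × {c : Fin n → ℕ // c 0 = 0}) : Ebar R n →ₗ[R] Ebar R n :=
  kosEmbed R n (Function.update i.2.2.2.1 0 i.2.1) ∘ₗ kosProj R n i.1 (n - (i.2.2.1 : ℕ)) ∘ₗ
    kosCoord R n (Function.update i.2.2.2.1 0 i.2.1)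

theorem range_pieceProj (i : ℕ × ℕ × Fin (n + 1) × {c : Fin n → ℕ // c 0 = 0}) :
    LinearMap.range (pieceProj R n i) =
      piece R n i.1 (n - (i.2.2.1 : ℕ) + 2 * i.2.1 + dimX i.2.2.2.1)
        (gens R n i.2.1 i.2.2.2.1 i.2.2.1) := by
  rw [piece_eq_map R _ i.2.2.2.2 (by omega) rfl, kosDeg, ← LinearMap.range_comp]
  refine le_antisymm ?_ ?_
  · rintro _ ⟨e, rfl⟩
    exact ⟨_, rfl⟩
  · rintro _ ⟨z, rfl⟩
    refine ⟨kosEmbed R n (Function.update i.2.2.2.1 0 i.2.1) z, ?_⟩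
    simp only [pieceProj, LinearMap.comp_apply, kosCoord_kosEmbed_self]

theorem isInternal_HE : DirectSum.IsInternal
    (fun i : ℕ × ℕ × Fin (n + 1) × {c : Fin n → ℕ // c 0 = 0} =>
      HE R n i.1 (n - (i.2.2.1 : ℕ) + 2 * i.2.1 + dimX i.2.2.2.1)
        (gens R n i.2.1 i.2.2.2.1 i.2.2.1)) := by
  have h := isInternal_homology (D R n) (pieceProj R n) ?_ ?_ ?_ ?_ ?_
  · simp only [range_pieceProj] at h
    exact h
  · intro i e
    simp only [pieceProj, LinearMap.comp_apply, kosCoord_kosEmbed_self]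
    rw [kosProj_of_mem R ⟨_, rfl⟩]
  · rintro ⟨p, m, j, c, hc⟩ ⟨p', m', j', c', hc'⟩ e hne
    simp only [pieceProj, LinearMap.comp_apply]
    by_cases hcc : Function.update c' 0 m' = Function.update c 0 m
    · rw [hcc, kosCoord_kosEmbed_self]
      have hm : m' = m := by simpa using congrFun hcc 0
      have hc2 : c' = c := by
        funext i
        by_cases hi : i = 0
        · rw [hi, hc, hc']
        · simpa [hi] using congrFun hcc i
      subst hm hc2
      rw [kosProj_of_mem_of_ne R (p := p') (k := n - j') ?_ ⟨_, rfl⟩, map_zero]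
      intro hpj
      rw [Prod.mk.injEq] at hpj
      obtain ⟨rfl, hj⟩ := hpj
      exact hne (by rw [show j = j' from Fin.ext (by omega)])
    · rw [kosCoord_kosEmbed_of_ne R n hcc, map_zero, map_zero]
  · rw [eq_top_iff, ← iSup_range_kosEmbed R n]
    refine iSup_le fun c => ?_
    rintro _ ⟨z, rfl⟩
    have hc : Function.update (Function.update c 0 0) 0 (c 0) = c := by simp
    have hz := Submodule.mem_map_of_mem (f := kosEmbed R n c) (mem_iSup_kosDeg R z)
    simp only [Submodule.map_iSup] at hz
    refine SetLike.le_def.1 (iSup_le fun p => iSup_le fun j => ?_) hz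
    refine le_trans ?_ (le_iSup _ (p, c 0, j, ⟨Function.update c 0 0, by simp⟩))
    rw [range_pieceProj, piece_eq_map R _ (by simp) (by omega) rfl, hc]
  · rintro ⟨p, m, j, c, hc⟩ e he
    simp only [pieceProj, LinearMap.comp_apply]
    rcases m with _ | m
    · exact D_kosEmbed_of_eq_zero R n _ (by simp) _
    · have hr : Function.update c 0 (m + 1) = raise (Function.update c 0 m) := by simp [raise]
      rw [hr, D_kosEmbed_raise, ← kosProj_succ_kosMap, ← kosCoord_D, he, map_zero, map_zero,
        map_zero]
  · rintro ⟨p, m, j, c, hc⟩ e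
    simp only [pieceProj, LinearMap.comp_apply]
    rw [kosEmbed_mem_range_D, kosCoord_D]
    rcases p with _ | p
    · rw [kosProj_kosMap_of_eq_zero R _ _ (Or.inl rfl)]; exact zero_mem _
    obtain hk | ⟨k, hk⟩ : n - (j : ℕ) = 0 ∨ ∃ k, n - (j : ℕ) = k + 1 :=
      (Nat.eq_zero_or_eq_succ_pred _).imp_right fun h => ⟨_, h⟩
    · rw [kosProj_kosMap_of_eq_zero R _ _ (Or.inr hk)]; exact zero_mem _
    · rw [hk, kosProj_succ_kosMap]
      exact ⟨_, rfl⟩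

end Pieces

/-! ### Exactness in bidegrees below the top -/

section Exactness

variable (R : Type*) [CommRing R] {n : ℕ}

theorem kosProj_kosMap_mem (p k : ℕ) (w : Kos R n) :
    kosProj R n p k (kosMap R n w) = 0 ∨ ∃ p' k', p = p' + 1 ∧ k = k' + 1 ∧
      kosProj R n p k (kosMap R n w) = kosMap R n (kosProj R n p' k' w) := by
  rcases p with _ | p
  · exact Or.inl (kosProj_kosMap_of_eq_zero R _ _ (Or.inl rfl) _)
  rcases k with _ | k
  · exact Or.inl (kosProj_kosMap_of_eq_zero R _ _ (Or.inr rfl) _)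
  · exact Or.inr ⟨p, k, rfl, rfl, kosProj_succ_kosMap R p k w⟩

theorem kosMap_eq_zero_of_mem_top {p k : ℕ} (hk : n ≤ k) {z : Kos R n} (hz : z ∈ kosDeg R n p k) :
    kosMap R n z = 0 := by
  have := kosMap_mem_kosDeg R hz
  rwa [kosDeg_eq_bot R _ (by omega), Submodule.mem_bot] at this

variable [IsDomain R] [CharZero R]

/-- Below the top exterior degree a homogeneous cycle is the boundary of a homogeneous element
(and is zero if there is no bidegree for such an element to live in). -/
theorem eq_zero_or_exists_of_kosMap_eq_zero {p k : ℕ} (hk : k < n) {z : Kos R n}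
    (hz : z ∈ kosDeg R n p k) (h : kosMap R n z = 0) :
    z = 0 ∨ ∃ p' k', p = p' + 1 ∧ k = k' + 1 ∧ ∃ w ∈ kosDeg R n p' k', kosMap R n w = z := by
  obtain ⟨w, b, hw⟩ := (kosMap_exact R).1 z h
  have hb : kosProj R n p k (b ⊗ₜ yProd R n Finset.univ) = 0 := by
    have hn : yProd R n Finset.univ ∈ ⋀[R]^n (Fin n → R) := by
      simpa using yProd_mem R n Finset.univ
    rw [kosProj, TensorProduct.map_tmul, proj_of_mem_ne (fun k => ⋀[R]^k (Fin n → R)) hk.ne' hn,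
      TensorProduct.tmul_zero]
  have hzw : z = kosProj R n p k (kosMap R n w) := by
    conv_lhs => rw [← kosProj_of_mem R hz, hw, map_add, hb, add_zero]
  rcases kosProj_kosMap_mem R p k w with h0 | ⟨p', k', hp, hk', h1⟩
  · exact Or.inl (hzw.trans h0)
  · exact Or.inr ⟨p', k', hp, hk', _, ⟨w, rfl⟩, (hzw.trans h1).symm⟩

theorem mem_range_kosMap_of_lt {p k : ℕ} (hk : k < n) {z : Kos R n}
    (hz : z ∈ kosDeg R n p k) (h : kosMap R n z = 0) : z ∈ LinearMap.range (kosMap R n) := by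
  rcases eq_zero_or_exists_of_kosMap_eq_zero R hk hz h with rfl | ⟨-, -, -, -, w, -, hw⟩
  · exact zero_mem _
  · exact ⟨w, hw⟩

end Exactness

/-! ### Ranks of the groups of Koszul boundaries -/

section Rank

variable (R : Type*) [CommRing R] {n : ℕ}

theorem finrank_map_add_finrank_inf_ker {R M N : Type*} [CommRing R] [IsDomain R] [AddCommGroup M]
    [AddCommGroup N] [Module R M] [Module R N] (g : M →ₗ[R] N) (S : Submodule R M)
    [Module.Finite R S] :
    Module.finrank R (S.map g) + Module.finrank R (S ⊓ LinearMap.ker g : Submodule R M) =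
      Module.finrank R S := by
  have h := (LinearMap.ker (g.domRestrict S)).finrank_quotient_add_finrank
  rw [(g.domRestrict S).quotKerEquivRange.finrank_eq, LinearMap.range_domRestrict,
    (Submodule.equivSubtypeMap S (LinearMap.ker (g.domRestrict S))).finrank_eq,
    LinearMap.ker_domRestrict, Submodule.map_comap_subtype] at h
  exact h

/-- The bihomogeneous part is spanned by the basis elements `γ^d ⊗ y_I` with `|d| = p` and
`|I| = k`. -/
theorem kosDeg_eq_span_basis (p k : ℕ) : kosDeg R n p k = Submodule.span R (Set.range
    fun x : ↥((Finset.univ.finsuppAntidiag p : Finset (Fin n →₀ ℕ)) ×ˢ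
        (Finset.univ : Finset (Fin n)).powersetCard k) =>
      ((MvPolynomial.basisMonomials (Fin n) R).tensorProduct (lamBasis R n)) x.1) := by
  refine le_antisymm ?_ (Submodule.span_le.2 ?_)
  · rw [kosDeg_eq_span, Submodule.span_le]
    rintro _ ⟨P, hP, l, hl, rfl⟩
    rw [SetLike.mem_coe]
    rw [exteriorPower_eq_span] at hl
    induction hl using Submodule.span_induction with
    | zero => simp
    | add u v _ _ hu hv => rw [TensorProduct.tmul_add]; exact add_mem hu hv
    | smul r u _ hu => rw [TensorProduct.tmul_smul]; exact Submodule.smul_mem _ r hu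
    | mem l hl =>
    obtain ⟨I, hI, rfl⟩ := hl
    rw [P.as_sum, TensorProduct.sum_tmul]
    refine sum_mem fun d hd => ?_
    have hdp : d.degree = p := by
      by_contra hne
      exact MvPolynomial.mem_support_iff.1 hd
        (MvPolynomial.IsHomogeneous.coeff_eq_zero hP hne)
    rw [← mul_one (MvPolynomial.coeff d P), ← smul_eq_mul, ← MvPolynomial.smul_monomial,
      ← TensorProduct.smul_tmul']
    refine Submodule.smul_mem _ _ (Submodule.subset_span ⟨⟨(d, I), ?_⟩, ?_⟩)
    · simp [Finset.mem_finsuppAntidiag, hI, ← hdp, Finsupp.degree_eq_sum]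
    · simp [Module.Basis.tensorProduct_apply, lamBasis_apply]
  · rintro _ ⟨⟨⟨d, I⟩, hx⟩, rfl⟩
    simp only [Finset.mem_product, Finset.mem_finsuppAntidiag, Finset.mem_powersetCard,
      Finset.subset_univ, and_true, true_and] at hx
    simp only [Module.Basis.tensorProduct_apply, lamBasis_apply, MvPolynomial.coe_basisMonomials]
    refine tmul_mem_kosDeg R (MvPolynomial.isHomogeneous_monomial _ ?_) ?_
    · rw [Finsupp.degree_eq_sum, hx.1]
    · rw [← hx.2]
      exact yProd_mem R n I

theorem finrank_kosDeg [Nontrivial R] (p k : ℕ) :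
    Module.finrank R (kosDeg R n p k) = n.choose k * n.multichoose p := by
  rw [kosDeg_eq_span_basis, finrank_span_eq_card]
  · rw [Fintype.card_coe, Finset.card_product, Finset.card_finsuppAntidiag_nat_eq_multichoose,
      Finset.card_powersetCard, Finset.card_univ, Fintype.card_fin, mul_comm]
  · exact (Module.Basis.linearIndependent _).comp _ Subtype.val_injective

instance finite_kosDeg (p k : ℕ) : Module.Finite R (kosDeg R n p k) := by
  rw [kosDeg_eq_span_basis]
  exact Module.Finite.span_of_finite R (Set.finite_range _)

/-- The image under the Koszul differential of the part of polynomial degree `p` and exterior degree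
`k`; it lies in polynomial degree `p + 1` and exterior degree `k + 1`. -/
def kosBoundary (n p k : ℕ) : Submodule R (Kos R n) :=
  (kosDeg R n p k).map ((kosMap R n).restrictScalars R)

theorem finrank_kosBoundary_add [IsDomain R] (p k : ℕ) :
    Module.finrank R (kosBoundary R n p k) + Module.finrank R
      ((kosDeg R n p k ⊓ LinearMap.ker ((kosMap R n).restrictScalars R) : Submodule R (Kos R n))) =
      n.choose k * n.multichoose p := by
  rw [← finrank_kosDeg R]
  exact finrank_map_add_finrank_inf_ker _ _

variable [IsDomain R] [CharZero R]

/-- By exactness, the rank of the boundaries is the alternating sum of the ranks of the preceding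
terms of the complex. -/
theorem finrank_kosBoundary (p k : ℕ) (hk : k < n) :
    (Module.finrank R (kosBoundary R n p k) : ℤ) = ∑ i ∈ Finset.range (k + 1),
      (-1 : ℤ) ^ i * (n.choose (k - i) : ℤ) * (multisetCoeff n ((p : ℤ) - i) : ℤ) := by
  have hmc : ∀ q : ℕ, multisetCoeff n (q : ℤ) = n.multichoose q := fun q => by
    simp [multisetCoeff]
  have hneg : ∀ i : ℕ, multisetCoeff n ((0 : ℕ) - ((i + 1 : ℕ) : ℤ)) = 0 := fun i => by
    rw [multisetCoeff, if_neg]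
    omega
  induction k generalizing p with
  | zero =>
    have hker : kosDeg R n p 0 ⊓ LinearMap.ker ((kosMap R n).restrictScalars R) = ⊥ := by
      rw [eq_bot_iff]
      rintro z ⟨hz, h0⟩
      rcases eq_zero_or_exists_of_kosMap_eq_zero R hk hz h0 with h | ⟨_, _, _, h, _⟩
      · exact h
      · omega
    have h := finrank_kosBoundary_add R (n := n) p 0
    rw [hker, finrank_bot, add_zero] at h
    rw [h]
    simp [hmc]
  | succ k ih =>
    rw [Finset.sum_range_succ']
    have h := finrank_kosBoundary_add R (n := n) p (k + 1)
    rcases p with _ | p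
    · have hker : kosDeg R n 0 (k + 1) ⊓ LinearMap.ker ((kosMap R n).restrictScalars R) = ⊥ := by
        rw [eq_bot_iff]
        rintro z ⟨hz, h0⟩
        rcases eq_zero_or_exists_of_kosMap_eq_zero R hk hz h0 with h | ⟨_, _, h, _⟩
        · exact h
        · omega
      rw [hker, finrank_bot, add_zero] at h
      rw [h]
      simp only [hneg]
      simp [multisetCoeff]
    -- The Koszul cycles are the boundaries from the previous bidegree, by exactness.
    · have hker : kosDeg R n (p + 1) (k + 1) ⊓ LinearMap.ker ((kosMap R n).restrictScalars R) =
          kosBoundary R n p k := by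
        refine le_antisymm ?_ ?_
        · rintro z ⟨hz, h0⟩
          rcases eq_zero_or_exists_of_kosMap_eq_zero R hk hz h0 with h | ⟨p', k', hp, hk', w, hw, h⟩
          · rw [h]; exact zero_mem _
          · obtain rfl : p = p' := by omega
            obtain rfl : k = k' := by omega
            exact ⟨w, hw, h⟩
        · rintro _ ⟨w, hw, rfl⟩
          exact ⟨kosMap_mem_kosDeg R hw, kosMap_kosMap R w⟩
      rw [hker] at h
      have ih' := ih p (by omega)
      have e : ∀ i : ℕ, (((p + 1 : ℕ) : ℤ) - ((i + 1 : ℕ) : ℤ)) = (p : ℤ) - i := fun i => by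
        push_cast; ring
      simp only [e, Nat.add_sub_add_right, pow_succ, mul_neg, mul_one, neg_mul,
        Finset.sum_neg_distrib]
      rw [← ih']
      have h' : (Module.finrank R (kosBoundary R n (p + 1) (k + 1)) : ℤ) +
        Module.finrank R (kosBoundary R n p k) = n.choose (k + 1) * n.multichoose (p + 1) := by
        exact_mod_cast h
      simp only [pow_zero, one_mul, Nat.sub_zero, Nat.cast_zero, sub_zero, hmc]
      linarith

end Rank

/-! ### The top Koszul homology `R[γ] / (γ̃_1, …, γ̃_n)` -/

section TopDegree

variable (R : Type*) [CommRing R] {n : ℕ}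

/-- The map `P ↦ P ⊗ y_1 ⋯ y_n` on homogeneous polynomials of degree `p`. -/
def topEmbed (p : ℕ) : MvPolynomial.homogeneousSubmodule (Fin n) R p →ₗ[R] Kos R n :=
  (TensorProduct.mk R (Pol R n) (Lam R n)).flip (yProd R n Finset.univ) ∘ₗ Submodule.subtype _

theorem exteriorPower_top : ⋀[R]^n (Fin n → R) = R ∙ yProd R n Finset.univ := by
  rw [exteriorPower_eq_span]
  congr 1
  ext l
  constructor
  · rintro ⟨I, hI, rfl⟩
    rw [Finset.card_eq_iff_eq_univ I |>.1 (by simpa using hI)]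
    rfl
  · rintro rfl
    exact ⟨_, by simp, rfl⟩

theorem range_topEmbed (p : ℕ) : LinearMap.range (topEmbed R p) = kosDeg R n p n := by
  refine le_antisymm ?_ ?_
  · rintro _ ⟨P, rfl⟩
    refine tmul_mem_kosDeg R P.2 ?_
    rw [exteriorPower_top]
    exact Submodule.mem_span_singleton_self _
  · rw [kosDeg_eq_span, Submodule.span_le]
    rintro _ ⟨P, hP, l, hl, rfl⟩
    rw [exteriorPower_top] at hl
    obtain ⟨r, rfl⟩ := Submodule.mem_span_singleton.1 hl
    refine ⟨r • ⟨P, hP⟩, ?_⟩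
    rw [map_smul, TensorProduct.tmul_smul]
    rfl

theorem topEmbed_mem_range [IsDomain R] [CharZero R] {p : ℕ}
    (P : MvPolynomial.homogeneousSubmodule (Fin n) R p) :
    topEmbed R p P ∈ LinearMap.range (kosMap R n) ↔ (P : Pol R n) ∈ gammaIdeal R n := by
  rw [(kosMap_exact R).2]
  exact ⟨fun ⟨w, hw⟩ => ⟨w, hw.symm⟩, fun ⟨w, hw⟩ => ⟨w, hw.symm⟩⟩

/-- No nonzero constant lies in the ideal. -/
theorem homogeneous_zero_mem_gammaIdeal {P : Pol R n}
    (hP : P ∈ MvPolynomial.homogeneousSubmodule (Fin n) R 0) :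
    P ∈ gammaIdeal R n ↔ MvPolynomial.constantCoeff P = 0 := by
  have hC : P = MvPolynomial.C (MvPolynomial.constantCoeff P) := by
    have := MvPolynomial.homogeneousComponent_zero P
    rw [MvPolynomial.homogeneousComponent_of_mem hP, if_pos rfl] at this
    exact this
  constructor
  · intro h
    have hle : gammaIdeal R n ≤ RingHom.ker (MvPolynomial.constantCoeff (R := R)) := by
      refine Ideal.span_le.2 ?_
      rintro _ ⟨i, rfl⟩
      simp [gammaTilde]
    exact hle h
  · intro h
    rw [hC, h, map_zero]
    exact zero_mem _

theorem eval_gammaTilde (i : Fin n) :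
    MvPolynomial.eval (fun _ => (1 : R)) (gammaTilde R i) = n + 1 := by
  simp [gammaTilde]

theorem natCast_succ_mul_sum_mem_gammaIdeal :
    ((n : Pol R n) + 1) * ∑ k, MvPolynomial.X k ∈ gammaIdeal R n := by
  have h : ((n : Pol R n) + 1) * ∑ k, MvPolynomial.X k = ∑ i, gammaTilde R i := by
    simp only [gammaTilde, Finset.sum_add_distrib, Finset.sum_const, Finset.card_univ,
      Fintype.card_fin, nsmul_eq_mul]
    ring
  rw [h]
  exact sum_mem fun i _ => Ideal.subset_span ⟨i, rfl⟩

/-- Modulo the ideal each `γ_i` equals `-(γ_1 + ⋯ + γ_n)`, so that a homogeneous polynomial is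
determined by its degree and by the sum of its coefficients. -/
theorem mk_homogeneous_eq {p : ℕ} {P : Pol R n}
    (hP : P ∈ MvPolynomial.homogeneousSubmodule (Fin n) R p) :
    Ideal.Quotient.mk (gammaIdeal R n) P = Ideal.Quotient.mk (gammaIdeal R n)
      (MvPolynomial.C (MvPolynomial.eval (fun _ => (1 : R)) P) *
        (-∑ k, MvPolynomial.X k) ^ p) := by
  have hX : ∀ i : Fin n, Ideal.Quotient.mk (gammaIdeal R n) (MvPolynomial.X i) =
      Ideal.Quotient.mk (gammaIdeal R n) (-∑ k, MvPolynomial.X k) := fun i => by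
    rw [Ideal.Quotient.eq, sub_neg_eq_add, add_comm]
    exact Ideal.subset_span ⟨i, rfl⟩
  conv_lhs => rw [P.as_sum]
  rw [MvPolynomial.eval_eq, map_sum, map_sum, Finset.sum_mul, map_sum]
  refine Finset.sum_congr rfl fun d hd => ?_
  have hdp : d.degree = p := by
    by_contra hne
    exact MvPolynomial.mem_support_iff.1 hd (MvPolynomial.IsHomogeneous.coeff_eq_zero hP hne)
  rw [MvPolynomial.monomial_eq, map_mul, map_mul, Finsupp.prod, map_prod]
  simp only [map_pow, hX, one_pow, Finset.prod_const_one, mul_one]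
  rw [Finset.prod_pow_eq_pow_sum, ← hdp]
  rfl

/-- In positive degree, membership in the ideal is detected by the sum of the coefficients modulo
`n + 1`: the ideal contains `(n + 1)(γ_1 + ⋯ + γ_n)`, and the value of each `γ̃_i` at `(1, …, 1)` is
`n + 1`. -/
theorem homogeneous_mem_gammaIdeal {p : ℕ} (hp : 0 < p) {P : Pol ℤ n}
    (hP : P ∈ MvPolynomial.homogeneousSubmodule (Fin n) ℤ p) :
    P ∈ gammaIdeal ℤ n ↔ ((MvPolynomial.eval (fun _ => (1 : ℤ)) P : ℤ) : ZMod (n + 1)) = 0 := by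
  constructor
  · intro h
    have hle : gammaIdeal ℤ n ≤ RingHom.ker ((Int.castRingHom (ZMod (n + 1))).comp
        (MvPolynomial.eval fun _ => (1 : ℤ))) := by
      refine Ideal.span_le.2 ?_
      rintro _ ⟨i, rfl⟩
      rw [SetLike.mem_coe, RingHom.mem_ker, RingHom.comp_apply, eval_gammaTilde]
      simp
    exact hle h
  · intro h
    obtain ⟨t, ht⟩ := (ZMod.intCast_zmod_eq_zero_iff_dvd _ (n + 1)).1 h
    rw [← Ideal.Quotient.eq_zero_iff_mem, mk_homogeneous_eq ℤ hP, ht,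
      Ideal.Quotient.eq_zero_iff_mem]
    obtain ⟨q, rfl⟩ : ∃ q, p = q + 1 := ⟨p - 1, by omega⟩
    have := Ideal.mul_mem_left _ (-MvPolynomial.C t * (-∑ k, MvPolynomial.X k) ^ q)
      (natCast_succ_mul_sum_mem_gammaIdeal ℤ (n := n))
    convert this using 1
    simp only [map_mul, Nat.cast_add, Nat.cast_one, map_add, map_natCast, map_one]
    ring

/-- The sum of the coefficients modulo `n + 1`, on homogeneous polynomials of degree `p`. -/
def evalOneMod (n p : ℕ) : MvPolynomial.homogeneousSubmodule (Fin n) ℤ p →ₗ[ℤ] ZMod (n + 1) :=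
  ((Int.castAddHom (ZMod (n + 1))).comp ((MvPolynomial.eval fun _ => (1 : ℤ)).toAddMonoidHom.comp
    (Submodule.subtype _).toAddMonoidHom)).toIntLinearMap

theorem evalOneMod_surjective (n p : ℕ) [NeZero n] : Function.Surjective (evalOneMod n p) := by
  intro x
  obtain ⟨a, rfl⟩ := ZMod.intCast_surjective x
  refine ⟨⟨MvPolynomial.C a * MvPolynomial.X 0 ^ p, ?_⟩, ?_⟩
  · simpa using (MvPolynomial.isHomogeneous_C (Fin n) a).mul
      ((MvPolynomial.isHomogeneous_X ℤ (0 : Fin n)).pow p)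
  · simp [evalOneMod]

/-- The value of a homogeneous polynomial of degree `0`. -/
def constantCoeffZero (n : ℕ) : MvPolynomial.homogeneousSubmodule (Fin n) ℤ 0 →ₗ[ℤ] ℤ :=
  ((MvPolynomial.constantCoeff (R := ℤ)).toAddMonoidHom.comp
    (Submodule.subtype _).toAddMonoidHom).toIntLinearMap

theorem constantCoeffZero_surjective (n : ℕ) : Function.Surjective (constantCoeffZero n) := by
  intro a
  exact ⟨⟨MvPolynomial.C a, MvPolynomial.isHomogeneous_C (Fin n) a⟩, by simp [constantCoeffZero]⟩

end TopDegree

/-! ### The homology groups of the pieces -/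

section Groups

theorem nonempty_submodule_map_equiv {R M N : Type*} [CommRing R] [IsDomain R]
    [IsPrincipalIdealRing R] [AddCommGroup M] [AddCommGroup N] [Module R M] [Module R N]
    [Module.Free R N] (g : M →ₗ[R] N) (S : Submodule R M) [Module.Finite R S] {r : ℕ}
    (hr : Module.finrank R (S.map g) = r) : Nonempty (S.map g ≃ₗ[R] (Fin r → R)) :=
  have : Module.Finite R (S.map g) := inferInstance
  ⟨(Module.finBasisOfFinrankEq R (S.map g) hr).equivFun⟩

variable {n : ℕ} [NeZero n]

/-- The pieces with `y_1 ⋯ y_n` are all cycles, so their homology is `A^p` modulo the ideal of the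
`γ̃_i`. -/
theorem nonempty_HE_top_equiv {p m q : ℕ} {c : Fin n → ℕ} (h : c 0 = 0)
    (hq : q = n + 2 * m + dimX c) {X : Type*} [AddCommGroup X] [Module ℤ X]
    (g : MvPolynomial.homogeneousSubmodule (Fin n) ℤ p →ₗ[ℤ] X) (hg : Function.Surjective g)
    (hker : ∀ P, g P = 0 ↔ (P : Pol ℤ n) ∈ gammaIdeal ℤ n) :
    Nonempty (HE ℤ n p q (gens ℤ n m c 0) ≃+ X) := by
  have hmem : ∀ P, topEmbed ℤ p P ∈ kosDeg ℤ n p n := fun P => by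
    rw [← range_topEmbed]; exact ⟨P, rfl⟩
  obtain ⟨e⟩ := nonempty_HE_equiv ℤ (p := p) (m := m) (q := q) h (Nat.zero_le n) hq
    (topEmbed ℤ p) g hg hmem
    (fun P => Or.inr (kosMap_eq_zero_of_mem_top ℤ le_rfl (hmem P)))
    (fun z hz _ => by
      rw [Nat.sub_zero, ← range_topEmbed] at hz
      exact hz)
    (fun P => by rw [hker, topEmbed_mem_range])
  exact ⟨e.toAddEquiv⟩

theorem finrank_kosBoundary_eq {p j : ℕ} (hj : 1 ≤ j) (hjn : j ≤ n) :
    (Module.finrank ℤ (kosBoundary ℤ n p (n - j)) : ℤ) = ∑ k ∈ Finset.range (n - j + 1),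
      (-1 : ℤ) ^ k * (n.choose (j + k) : ℤ) * (multisetCoeff n ((p : ℤ) - k) : ℤ) := by
  have hn : 0 < n := Nat.pos_of_ne_zero (NeZero.ne n)
  rw [finrank_kosBoundary ℤ (n := n) p (n - j) (by omega)]
  refine Finset.sum_congr rfl fun k hk => ?_
  rw [Finset.mem_range] at hk
  rw [Nat.choose_symm_of_eq_add (by omega : n = (n - j - k) + (j + k))]

/-- For `m = 0` and `j ≥ 1` all elements of the piece are cycles, and by exactness the Koszul
differential identifies the quotient by the boundaries with its own image, which is free. -/
theorem nonempty_HE_lower_equiv {p j q r : ℕ} {c : Fin n → ℕ} (h : c 0 = 0) (hj : 1 ≤ j)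
    (hjn : j ≤ n) (hq : q = n - j + dimX c)
    (hr : Module.finrank ℤ (kosBoundary ℤ n p (n - j)) = r) :
    Nonempty (HE ℤ n p q (gens ℤ n 0 c j) ≃+ (Fin r → ℤ)) := by
  have hn : 0 < n := Nat.pos_of_ne_zero (NeZero.ne n)
  have hlt : n - j < n := by omega
  set K : Kos ℤ n →ₗ[ℤ] Kos ℤ n := (kosMap ℤ n).restrictScalars ℤ
  obtain ⟨e⟩ := nonempty_HE_equiv ℤ (p := p) (m := 0) (q := q) h hjn (by omega)
    (U := kosDeg ℤ n p (n - j)) (X := (kosDeg ℤ n p (n - j)).map K)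
    (kosDeg ℤ n p (n - j)).subtype (K.submoduleMap (kosDeg ℤ n p (n - j)))
    (K.submoduleMap_surjective _) (fun u => u.2) (fun _ => Or.inl rfl)
    (fun z hz _ => ⟨⟨z, hz⟩, rfl⟩) (fun u => by
      rw [← Subtype.coe_inj]
      constructor
      · intro hu
        exact mem_range_kosMap_of_lt ℤ hlt u.2 hu
      · rintro ⟨w, hw⟩
        change kosMap ℤ n u = 0
        rw [Submodule.subtype_apply] at hw
        rw [← hw, kosMap_kosMap])
  have : Module.Free ℤ (Kos ℤ n) :=
    Module.Free.of_basis ((MvPolynomial.basisMonomials (Fin n) ℤ).tensorProduct (lamBasis ℤ n))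
  obtain ⟨e'⟩ := nonempty_submodule_map_equiv K (kosDeg ℤ n p (n - j)) hr
  exact ⟨(e ≪≫ₗ e').toAddEquiv⟩

theorem HE_eq_bot {p m j : ℕ} {c : Fin n → ℕ} (hm : 1 ≤ m) (hj : 1 ≤ j) (hjn : j ≤ n)
    (h : c 0 = 0) : HE ℤ n p (n - j + 2 * m + dimX c) (gens ℤ n m c j) = ⊥ := by
  have hn : 0 < n := Nat.pos_of_ne_zero (NeZero.ne n)
  rw [HE, piece_eq_map ℤ c h hjn rfl, eq_bot_iff]
  rintro _ ⟨⟨_, hz⟩, ⟨z, hzm, rfl⟩, rfl⟩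
  have hz' := (D_kosEmbed_eq_zero ℤ).1 (LinearMap.mem_ker.1 hz)
  rw [Function.update_self] at hz'
  rw [Submodule.mem_bot, Submodule.mkQ_apply, Submodule.Quotient.mk_eq_zero]
  exact (kosEmbed_mem_range_D ℤ).2
    (mem_range_kosMap_of_lt ℤ (by omega) hzm (hz'.resolve_left (by omega)))

end Groups

end FlagLoop

end

open FlagLoop in
theorem mainTheorem6 (n : ℕ) [NeZero n] :
    -- the classes `(x_2)_m X y_1 ⋯ y_n`
    (∀ (m : ℕ) (c : Fin n → ℕ), c 0 = 0 →
      Nonempty (HE ℤ n 0 (n + 2 * m + dimX c) (gens ℤ n m c 0) ≃+ ℤ)) ∧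
    (∀ (p m : ℕ) (c : Fin n → ℕ), 0 < p → c 0 = 0 →
      Nonempty (HE ℤ n p (n + 2 * m + dimX c) (gens ℤ n m c 0) ≃+ ZMod (n + 1))) ∧
    -- the classes `X ŷ_{i_1,…,i_j}` with `1 ≤ j ≤ n - 1`
    (∀ (p j : ℕ) (c : Fin n → ℕ), 1 ≤ j → j ≤ n - 1 → c 0 = 0 →
      ∃ r : ℕ, (r : ℤ) = ∑ k ∈ Finset.range (n - j + 1),
          (-1 : ℤ) ^ k * (n.choose (j + k) : ℤ) * (multisetCoeff n ((p : ℤ) - k) : ℤ) ∧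
        Nonempty (HE ℤ n p (n - j + dimX c) (gens ℤ n 0 c j) ≃+ (Fin r → ℤ))) ∧
    -- the classes `X`
    (∀ (p : ℕ) (c : Fin n → ℕ), c 0 = 0 →
      Nonempty (HE ℤ n p (dimX c) (gens ℤ n 0 c n) ≃+ (Fin (multisetCoeff n p) → ℤ))) ∧
    -- the remaining pieces contribute nothing
    (∀ (p m j : ℕ) (c : Fin n → ℕ), 1 ≤ m → 1 ≤ j → j ≤ n → c 0 = 0 →
      HE ℤ n p (n - j + 2 * m + dimX c) (gens ℤ n m c j) = ⊥) ∧
    -- the homology is the direct sum of all these pieces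
    DirectSum.IsInternal
      (fun i : ℕ × ℕ × Fin (n + 1) × {c : Fin n → ℕ // c 0 = 0} =>
        HE ℤ n i.1 (n - (i.2.2.1 : ℕ) + 2 * i.2.1 + dimX i.2.2.2.1)
          (gens ℤ n i.2.1 i.2.2.2.1 i.2.2.1)) := by
  have hn : 1 ≤ n := Nat.pos_of_ne_zero (NeZero.ne n)
  refine ⟨fun m c h => ?_, fun p m c hp h => ?_, fun p j c hj hjn h => ?_, fun p c h => ?_,
    fun p m j c hm hj hjn h => HE_eq_bot hm hj hjn h, isInternal_HE ℤ n⟩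
  · exact nonempty_HE_top_equiv h rfl (constantCoeffZero n) (constantCoeffZero_surjective n)
      fun P => (homogeneous_zero_mem_gammaIdeal ℤ P.2).symm
  · exact nonempty_HE_top_equiv h rfl (evalOneMod n p) (evalOneMod_surjective n p)
      fun P => (homogeneous_mem_gammaIdeal hp P.2).symm
  · exact ⟨_, finrank_kosBoundary_eq hj (by omega),
      nonempty_HE_lower_equiv h hj (by omega) rfl rfl⟩
  · refine nonempty_HE_lower_equiv h hn le_rfl (by simp) ?_
    rw [← Nat.cast_inj (R := ℤ), finrank_kosBoundary_eq hn le_rfl]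
    simp
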